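/- **Setting.** Let $\Omega$ be a compact Hausdorff space and $B(\Omega)$ the space of real-valued Borel functions on $\Omega$. An admissible quasinorm is a map $\|\cdot\|_X:B(\Omega)\to[0,\infty]$ such that (a) $\|f\|_X\le\|g\|_X$ whenever $|f|\le|g|$ pointwise; (b) $\|\alpha f\|_X=|\alpha|\,\|f\|_X$ for $\alpha\in\mathbb R$ (with $0\cdot\infty=0$); (c) there is a constant $C$ with $\|f+g\|_X\le C(\|f\|_X+\|g\|_X)$ for all $f,g\ge0$ with disjoint supports; (d) some strictly positive $u\in B(\Omega)$ has $0<\|u\|_X<\infty$; (e) if $0\le f_n\uparrow f$ pointwise, then $\|f_n\|_X\to\|f\|_X$. The set $X=\{f\in B(\Omega):\|f\|_X<\infty\}$ is then called a quasi-Banach function space on $\Omega$. It satisfies an upper $p$-estimate if $\|f_1+\dots+f_n\|_X\le(\sum_i\|f_i\|_X^p)^{1/p}$, and a lower $q$-estimate if $\|f_1+\dots+f_n\|_X\ge(\sum_i\|f_i\|_X^q)^{1/q}$, for all disjointly supported $f_1,\dots,f_n\in X$. For $r>0$, $M^{(r)}(X)\in[0,\infty]$ is the least constant $M$ with $\|(\sum_i|f_i|^r)^{1/r}\|_X\le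 M(\sum_i\|f_i\|_X^r)^{1/r}$ for all $f_1,\dots,f_n\in X$, and $M^{(0)}(X)$ is the least constant $M$ with $\||f_1\cdots f_n|^{1/n}\|_X\le M(\prod_i\|f_i\|_X)^{1/n}$ for all $n\ge1$ and $f_1,\dots,f_n\in X$. **Theorem 3.6.** (1) Let $0<r<p<\infty$. Then there is a constant $c=c(r,p)$ such that, if $X$ is a quasi-Banach function space (on any compact Hausdorff space) satisfying an upper $p$-estimate and a lower $q$-estimate, where $q/p=1+\theta$ with $0\le\theta<1$, then $$\log M^{(r)}(X)\le\theta\Bigl(c+\frac1p|\log\theta|\Bigr),$$ the right-hand side being read as $0$ when $\theta=0$. In particular $M^{(r)}(X)<\infty$. (2) The order $\theta|\log\theta|$ is sharp. For $0<p<q$ let $\Lambda_{p,q}[0,1]$ be given by $$\|f\|_{\Lambda_{p,q}}=\sup\Bigl(\sum_{i=1}^n\bigl(\inf_{A_i}|f|\bigr)^q\,\mu(A_i)^{q/p}\Bigr)^{1/q},$$ where $\mu$ is Lebesgue measure on $[0,1]$ and the supremum is over all finite Borel partitions $\{A_1,\dots,A_n\}$ of $[0,1]$. There are absolute constants $k>0$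 and $\theta_0>0$ such that for all $p>0$ and $0<\theta<\theta_0$, with $q=p(1+\theta)$, the space $\Lambda_{p,q}[0,1]$ is a quasi-Banach function space with an upper $p$-estimate and a lower $q$-estimate, and $$\log M^{(0)}(\Lambda_{p,q}[0,1])\ge\frac kp\,\theta|\log\theta|,\qquad \log M^{(r)}(\Lambda_{p,q}[0,1])\ge\frac kp\,\theta|\log\theta|\quad\text{for all }0<r<p.$$ -/

import Mathlib

open scoped ENNReal

/-- An admissible extended-value quasinorm on the space `B(Ω)` of real-valued Borel functions
on `Ω`. All conditions concern measurable functions only, so the values of `N` at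
non-measurable functions play no role. The associated quasi-Banach function space is
`X = {f ∈ B(Ω) : N f < ∞}`. -/
structure IsAdmissibleQuasinorm {Ω : Type*} [MeasurableSpace Ω]
    (N : (Ω → ℝ) → ℝ≥0∞) : Prop where
  /-- monotonicity -/
  mono : ∀ f g : Ω → ℝ, Measurable f → Measurable g → (∀ x, |f x| ≤ |g x|) → N f ≤ N g
  /-- homogeneity (with the convention `0 * ∞ = 0`) -/
  smul : ∀ (α : ℝ) (f : Ω → ℝ), Measurable f → N (fun x => α * f x) = ‖α‖ₑ * N f
  /-- quasi-triangle inequality for disjointly supported nonnegative functions -/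
  quasi_add : ∃ C : ℝ, ∀ f g : Ω → ℝ, Measurable f → Measurable g →
    (∀ x, 0 ≤ f x) → (∀ x, 0 ≤ g x) →
    Disjoint (Function.support f) (Function.support g) →
    N (fun x => f x + g x) ≤ ENNReal.ofReal C * (N f + N g)
  /-- existence of a strictly positive function in the space, of nonzero quasinorm -/
  exists_pos : ∃ u : Ω → ℝ, Measurable u ∧ (∀ x, 0 < u x) ∧ 0 < N u ∧ N u < ∞
  /-- the Fatou property -/
  fatou : ∀ (F : ℕ → Ω → ℝ) (f : Ω → ℝ), (∀ n, Measurable (F n)) → Measurable f →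
    (∀ n x, 0 ≤ F n x) → (∀ x, Monotone fun n => F n x) →
    (∀ x, Filter.Tendsto (fun n => F n x) Filter.atTop (nhds (f x))) →
    Filter.Tendsto (fun n => N (F n)) Filter.atTop (nhds (N f))

/-- `f` is an element of the function space of `N`: a Borel function of finite quasinorm. -/
def MemSpace {Ω : Type*} [MeasurableSpace Ω] (N : (Ω → ℝ) → ℝ≥0∞) (f : Ω → ℝ) : Prop :=
  Measurable f ∧ N f < ∞

/-- (Strict) upper `p`-estimate: `‖f₁ + ⋯ + fₙ‖ ≤ (∑ ‖fᵢ‖ ^ p) ^ (1 / p)` for disjoint `fᵢ`. -/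
def UpperEstimate {Ω : Type*} [MeasurableSpace Ω] (N : (Ω → ℝ) → ℝ≥0∞) (p : ℝ) : Prop :=
  ∀ (n : ℕ) (f : Fin n → Ω → ℝ), (∀ i, MemSpace N (f i)) →
    (Pairwise fun i j => Disjoint (Function.support (f i)) (Function.support (f j))) →
    N (fun x => ∑ i, f i x) ≤ (∑ i, N (f i) ^ p) ^ (1 / p)

/-- (Strict) lower `q`-estimate: `(∑ ‖fᵢ‖ ^ q) ^ (1 / q) ≤ ‖f₁ + ⋯ + fₙ‖` for disjoint `fᵢ`. -/
def LowerEstimate {Ω : Type*} [MeasurableSpace Ω] (N : (Ω → ℝ) → ℝ≥0∞) (q : ℝ) : Prop :=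
  ∀ (n : ℕ) (f : Fin n → Ω → ℝ), (∀ i, MemSpace N (f i)) →
    (Pairwise fun i j => Disjoint (Function.support (f i)) (Function.support (f j))) →
    (∑ i, N (f i) ^ q) ^ (1 / q) ≤ N (fun x => ∑ i, f i x)

/-- The `r`-convexity constant `M^{(r)}(X)`, `r > 0`, possibly infinite. -/
noncomputable def convexityConst {Ω : Type*} [MeasurableSpace Ω]
    (N : (Ω → ℝ) → ℝ≥0∞) (r : ℝ) : ℝ≥0∞ :=
  sInf {M : ℝ≥0∞ | ∀ (n : ℕ) (f : Fin n → Ω → ℝ), (∀ i, MemSpace N (f i)) →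
    N (fun x => (∑ i, |f i x| ^ r) ^ (1 / r)) ≤ M * (∑ i, N (f i) ^ r) ^ (1 / r)}

/-- The geometric convexity constant `M^{(0)}(X)`, possibly infinite. -/
noncomputable def geomConvexityConst {Ω : Type*} [MeasurableSpace Ω]
    (N : (Ω → ℝ) → ℝ≥0∞) : ℝ≥0∞ :=
  sInf {M : ℝ≥0∞ | ∀ (n : ℕ) (f : Fin n → Ω → ℝ), 0 < n → (∀ i, MemSpace N (f i)) →
    N (fun x => (∏ i, |f i x|) ^ (1 / (n : ℝ))) ≤ M * (∏ i, N (f i)) ^ (1 / (n : ℝ))}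

/-- The quasinorm of `Λ_{p,q}(μ)` for `p < q`: the supremum over all finite Borel partitions
`A₁, …, Aₙ` of `Ω` of `(∑ (inf_{Aᵢ} |f|) ^ q * μ(Aᵢ) ^ (q / p)) ^ (1 / q)`.
(An empty cell contributes `∞ * 0 = 0`.) -/
noncomputable def lambdaNorm {Ω : Type*} [MeasurableSpace Ω] (μ : MeasureTheory.Measure Ω)
    (p q : ℝ) (f : Ω → ℝ) : ℝ≥0∞ :=
  ⨆ (n : ℕ) (A : Fin n → Set Ω) (_ : ∀ i, MeasurableSet (A i))
    (_ : Pairwise fun i j => Disjoint (A i) (A j)) (_ : ⋃ i, A i = Set.univ),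
    (∑ i, (⨅ x ∈ A i, ‖f x‖ₑ) ^ q * μ (A i) ^ (q / p)) ^ (1 / q)

/-!
Replacing `N` by `N ^ p`, one may think of `p = 1` and `q = 1 + θ`.

**Upper bound.** For a function `F = (∑ |f i| ^ r) ^ (1 / r)` the set function
`φ A = N (F 1_A) ^ p` is a submeasure whose `(1 + θ)`-th power is superadditive. The key fact,
`IsLowerSubmeasure.le_fractional_cover`, is that the cost `∑ d i * φ (A i)` of a fractional cover is
at least `φ univ / (1 + 3 θ)`. Take a cheapest fractional cover `c`, of cost `δ`, and remove random
members of it from the whole space one after the other. If each point is in the remaining set `U`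
with probability at most `x`, then the sets `A \ U` still cover the proportion `1 - x` of each
point, so that they cost at least `(1 - x) δ` on average by minimality; the superadditivity of
`φ ^ (1 + θ)` then leaves little room for the sets `A ∩ U`, whose average cost is at most
`(x ^ (1 - θ / 2) + θ x ^ (1 / 2)) δ`. As these are the pieces that are removed from `U`, summing
over all the steps gives `φ univ ≤ (1 + O(θ)) δ`.

The cover to which this is applied consists of the level sets of the ratios `(|f i| / F) ^ p`, with
levels spaced geometrically with ratio `exp (-θ)`. Its weights come from the tangent-type inequality
`(y ^ R - (1 - R)) / R ≤ y` with `R = r / p`. The lower estimate bounds the `ℓ_{1 + θ}`-norm of the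
contributions of the levels of each `f i`, and Hölder's inequality turns it into a bound for the
weighted sum. Only about `C / θ` levels carry weight (`exists_sum_mul_convexityWeight_le`), which
costs the factor `(C / θ) ^ θ = exp (θ (log C + |log θ|))`.

**Sharpness.** In `Λ_{p,q}[0,1]` take the step function `exp (θ k / p)` on the `k`-th of `n` equal
intervals, with `n ≈ θ ^ (-1 / 2)`. Hölder's inequality on each cell of a partition
(`sum_rpow_le_of_levels`) shows that its quasinorm is smaller than its `L_q`-norm by a factor of
about `n ^ (-θ / q)`, whereas its `L_q`-norm exceeds its geometric mean only by a factor
`exp (O(θ / p))`, since the logarithm of its `p`-th power has variance `O(θ)`. The `n` cyclic shifts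
of this function have the same bound for the quasinorm and a constant geometric mean, which bounds
both constants of convexity from below.
-/

/-! ### Fractional covers for submeasures with a lower estimate -/

/-- A linearised form of `s ^ (1 + θ) + b ^ (1 + θ) ≤ a ^ (1 + θ)`, by Hölder's inequality with
the weights `1` and `κ`. -/
lemma le_of_rpow_add_rpow_le {θ a b s κ : ℝ} (hθ : 0 < θ) (ha : 0 ≤ a) (hb : 0 ≤ b) (hs : 0 ≤ s)
    (hκ : 0 < κ) (h : s ^ (1 + θ) + b ^ (1 + θ) ≤ a ^ (1 + θ)) :
    s ≤ (κ + θ * κ ^ (-(1 / θ))) * a - κ * b := by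
  have hq : (1 : ℝ) < 1 + θ := by linarith
  have hpq : (1 + θ).HolderConjugate ((1 + θ) / θ) := by
    rw [Real.holderConjugate_iff]
    refine ⟨hq, ?_⟩
    field_simp
  have H := Real.inner_le_Lp_mul_Lq (Finset.univ : Finset (Fin 2)) ![s, b] ![1, κ] hpq
  simp only [Fin.sum_univ_two, Matrix.cons_val_zero, Matrix.cons_val_one, abs_of_nonneg hs,
    abs_of_nonneg hb, abs_one, abs_of_pos hκ, mul_one, Real.one_rpow] at H
  have h1 : (s ^ (1 + θ) + b ^ (1 + θ)) ^ (1 / (1 + θ)) ≤ a := by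
    calc _ ≤ (a ^ (1 + θ)) ^ (1 / (1 + θ)) := by
          apply Real.rpow_le_rpow (by positivity) h (by positivity)
      _ = a := by rw [← Real.rpow_mul ha, mul_one_div_cancel (by positivity), Real.rpow_one]
  have h2 : (1 + κ ^ ((1 + θ) / θ)) ^ (1 / ((1 + θ) / θ)) ≤ κ + θ * κ ^ (-(1 / θ)) := by
    have e1 : 1 + κ ^ ((1 + θ) / θ) = κ ^ ((1 + θ) / θ) * (1 + κ ^ (-((1 + θ) / θ))) := by
      rw [mul_add, ← Real.rpow_add hκ]
      simp [add_comm]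
    rw [e1, Real.mul_rpow (by positivity) (by positivity), ← Real.rpow_mul hκ.le,
      mul_one_div_cancel (by positivity), Real.rpow_one]
    have e2 : (1 + κ ^ (-((1 + θ) / θ))) ^ (1 / ((1 + θ) / θ))
        ≤ 1 + 1 / ((1 + θ) / θ) * κ ^ (-((1 + θ) / θ)) := by
      apply rpow_one_add_le_one_add_mul_self
      · have : 0 < κ ^ (-((1 + θ) / θ)) := by positivity
        linarith
      · positivity
      · rw [div_le_one (by positivity), le_div_iff₀ hθ]; linarith
    have e3 : κ * κ ^ (-((1 + θ) / θ)) = κ ^ (-(1 / θ)) := by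
      nth_rewrite 1 [← Real.rpow_one κ]
      rw [← Real.rpow_add hκ]
      congr 1
      field_simp
      ring
    calc κ * (1 + κ ^ (-((1 + θ) / θ))) ^ (1 / ((1 + θ) / θ))
        ≤ κ * (1 + 1 / ((1 + θ) / θ) * κ ^ (-((1 + θ) / θ))) := by gcongr
      _ = κ + 1 / ((1 + θ) / θ) * (κ * κ ^ (-((1 + θ) / θ))) := by ring
      _ ≤ κ + θ * κ ^ (-(1 / θ)) := by
          rw [e3]
          have : 1 / ((1 + θ) / θ) ≤ θ := by
            rw [one_div_div, div_le_iff₀ (by positivity)]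
            nlinarith
          gcongr
  have h3 : s + b * κ ≤ a * (κ + θ * κ ^ (-(1 / θ))) := by
    refine H.trans ?_
    exact mul_le_mul h1 h2 (by positivity) ha
  linarith

/-- A nonnegative set function on the subsets of a finite set which is subadditive and whose power
of exponent `1 + θ` is superadditive on disjoint sets. -/
structure IsLowerSubmeasure {α : Type*} [DecidableEq α] (θ : ℝ) (φ : Finset α → ℝ) : Prop where
  nonneg : ∀ A, 0 ≤ φ A
  subadd : ∀ A B, Disjoint A B → φ (A ∪ B) ≤ φ A + φ B
  lower : ∀ A B, Disjoint A B → φ A ^ (1 + θ) + φ B ^ (1 + θ) ≤ φ (A ∪ B) ^ (1 + θ)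

namespace IsLowerSubmeasure

variable {α : Type*} [DecidableEq α] {θ : ℝ} {φ : Finset α → ℝ}

lemma empty (h : IsLowerSubmeasure θ φ) : φ ∅ = 0 := by
  have := h.lower ∅ ∅ (by simp)
  simp only [Finset.union_idempotent, add_le_iff_nonpos_left] at this
  have h0 := h.nonneg ∅
  by_contra hne
  have : 0 < φ ∅ ^ (1 + θ) := Real.rpow_pos_of_pos (lt_of_le_of_ne h0 (Ne.symm hne)) _
  linarith

lemma le_sum (h : IsLowerSubmeasure θ φ) (A : Finset α) :
    φ A ≤ ∑ a ∈ A, φ {a} := by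
  induction A using Finset.induction_on with
  | empty => simp [h.empty]
  | insert a s ha ih =>
    rw [Finset.sum_insert ha, Finset.insert_eq]
    refine (h.subadd _ _ (by simpa using ha)).trans (by gcongr)

variable [Fintype α]

/-- Among the fractional covers of the whole set there is one of least cost, and its cost bounds
the cost of every weighted family from below, in proportion to how much the family covers. -/
lemma exists_min_cover [Nonempty α] (h : IsLowerSubmeasure θ φ) :
    ∃ c : Finset α → ℝ, (∀ A, 0 ≤ c A) ∧ (∀ a, 1 ≤ ∑ A, if a ∈ A then c A else 0) ∧
      ∀ (d : Finset α → ℝ) (x : ℝ), (∀ A, 0 ≤ d A) → 0 ≤ x →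
        (∀ a, x ≤ ∑ A, if a ∈ A then d A else 0) → x * ∑ A, c A * φ A ≤ ∑ A, d A * φ A := by
  let K : Set (Finset α → ℝ) :=
    Set.Icc 0 1 ∩ ⋂ a, {c | 1 ≤ ∑ A, if a ∈ A then c A else 0}
  have hcl : IsClosed (⋂ a : α, {c : Finset α → ℝ | 1 ≤ ∑ A, if a ∈ A then c A else 0}) := by
    refine isClosed_iInter fun a => isClosed_le continuous_const ?_
    refine continuous_finsetSum _ fun A _ => ?_
    split_ifs
    · exact continuous_apply A
    · exact continuous_const
  have hK : IsCompact K := isCompact_Icc.inter_right hcl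
  have hKne : K.Nonempty := by
    refine ⟨1, by simp, ?_⟩
    simp only [Set.mem_iInter, Set.mem_ofPred_eq]
    intro a
    calc (1 : ℝ) = if a ∈ ({a} : Finset α) then (1 : Finset α → ℝ) {a} else 0 := by simp
      _ ≤ _ := Finset.single_le_sum (f := fun A => if a ∈ A then (1 : Finset α → ℝ) A else 0)
          (fun A _ => by split_ifs <;> simp) (Finset.mem_univ _)
  obtain ⟨c, hcK, hmin⟩ := hK.exists_isMinOn hKne
    (f := fun c => ∑ A, c A * φ A) (by fun_prop)
  have hc1 := hcK.2
  simp only [Set.mem_iInter, Set.mem_ofPred_eq] at hc1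
  refine ⟨c, fun A => hcK.1.1 A, hc1, ?_⟩
  intro d x hd hx hcov
  rcases hx.eq_or_lt with rfl | hx
  · rw [zero_mul]
    exact Finset.sum_nonneg fun A _ => mul_nonneg (hd A) (h.nonneg A)
  -- rescale to a cover and cap the weights at `1`
  have hmem : (fun A => min 1 (d A / x)) ∈ K := by
    refine ⟨⟨fun A => le_min zero_le_one (div_nonneg (hd A) hx.le), fun A => min_le_left _ _⟩, ?_⟩
    simp only [Set.mem_iInter, Set.mem_ofPred_eq]
    intro a
    by_cases hbig : ∃ A, a ∈ A ∧ 1 ≤ d A / x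
    · obtain ⟨A, haA, hA⟩ := hbig
      calc (1 : ℝ) = if a ∈ A then min 1 (d A / x) else 0 := by simp [haA, hA]
        _ ≤ _ := Finset.single_le_sum (f := fun A => if a ∈ A then min 1 (d A / x) else 0)
          (fun A _ => by
            split_ifs
            · exact le_min zero_le_one (div_nonneg (hd A) hx.le)
            · exact le_rfl) (Finset.mem_univ _)
    · push Not at hbig
      have : ∑ A, (if a ∈ A then min 1 (d A / x) else 0)
          = (∑ A, if a ∈ A then d A else 0) / x := by
        rw [Finset.sum_div]
        refine Finset.sum_congr rfl fun A _ => ?_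
        split_ifs with haA
        · exact min_eq_right (hbig A haA).le
        · simp
      rw [this, le_div_iff₀ hx, one_mul]
      exact hcov a
  have hle : ∑ A, c A * φ A ≤ ∑ A, min 1 (d A / x) * φ A := hmin hmem
  calc x * ∑ A, c A * φ A ≤ x * ∑ A, (d A / x) * φ A := by
        refine mul_le_mul_of_nonneg_left (hle.trans ?_) hx.le
        gcongr with A
        · exact h.nonneg A
        · exact min_le_right _ _
    _ = ∑ A, d A * φ A := by
        rw [Finset.mul_sum]
        refine Finset.sum_congr rfl fun A _ => ?_
        field_simp

/-- One step of the random process: from a random set `U` (with law `P`) containing each point with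
probability at most `x`, remove a member `A` of a fractional cover chosen with probability
proportional to its weight `c A`. -/
lemma exists_law_step (h : IsLowerSubmeasure θ φ) (hθ : 0 < θ) {c : Finset α → ℝ}
    (hc0 : ∀ A, 0 ≤ c A) (hc1 : ∀ a, 1 ≤ ∑ A, if a ∈ A then c A else 0)
    (hmin : ∀ (d : Finset α → ℝ) (x : ℝ), (∀ A, 0 ≤ d A) → 0 ≤ x →
        (∀ a, x ≤ ∑ A, if a ∈ A then d A else 0) → x * ∑ A, c A * φ A ≤ ∑ A, d A * φ A)
    {u : ℝ} (hu : 0 ≤ u) (huc : u * ∑ A, c A ≤ 1) {x : ℝ} (hx : 0 < x) (hx1 : x ≤ 1)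
    {P : Finset α → ℝ} (hP0 : ∀ U, 0 ≤ P U) (hP1 : ∑ U, P U = 1)
    (hPx : ∀ a, ∑ U, (if a ∈ U then P U else 0) ≤ x) :
    ∃ P' : Finset α → ℝ, (∀ U, 0 ≤ P' U) ∧ ∑ U, P' U = 1 ∧
      (∀ a, ∑ U, (if a ∈ U then P' U else 0) ≤ (1 - u) * x) ∧
      ∑ U, P U * φ U ≤ u * ((x ^ (1 - θ / 2) + θ * x ^ (1 / 2 : ℝ)) * ∑ A, c A * φ A)
        + ∑ U, P' U * φ U := by
  set S := ∑ A, c A with hS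
  let P' : Finset α → ℝ := fun V => ∑ U, P U * ((1 - u * S) * (if U = V then 1 else 0)
    + u * ∑ A, c A * (if U \ A = V then 1 else 0))
  have hE : ∀ G : Finset α → ℝ, ∑ V, P' V * G V
      = ∑ U, P U * ((1 - u * S) * G U + u * ∑ A, c A * G (U \ A)) := by
    intro G
    simp only [P', Finset.sum_mul]
    rw [Finset.sum_comm]
    refine Finset.sum_congr rfl fun U _ => ?_
    simp only [mul_assoc, ← Finset.mul_sum, add_mul, Finset.sum_add_distrib, Finset.sum_mul]
    rw [Finset.sum_comm]
    simp
  clear_value S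
  have hind : ∀ (Q : Finset α → ℝ) (a : α),
      ∑ U, (if a ∈ U then Q U else 0) = ∑ U, Q U * (if a ∈ U then 1 else 0) := by
    intro Q a
    simp
  refine ⟨P', ?_, ?_, ?_, ?_⟩
  · intro V
    refine Finset.sum_nonneg fun U _ => mul_nonneg (hP0 U) (add_nonneg ?_ ?_)
    · refine mul_nonneg (by linarith) (by split_ifs <;> simp)
    · refine mul_nonneg hu (Finset.sum_nonneg fun A _ => mul_nonneg (hc0 A) ?_)
      split_ifs <;> simp
  · have := hE fun _ => 1
    simp only [mul_one, ← hS] at this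
    rw [this]
    simp [hP1]
  · intro a
    rw [hind, hE]
    have key : ∀ U : Finset α, (1 - u * S) * (if a ∈ U then 1 else 0)
        + u * ∑ A, c A * (if a ∈ U \ A then 1 else 0) ≤ (1 - u) * (if a ∈ U then 1 else 0) := by
      intro U
      by_cases haU : a ∈ U
      · simp only [haU, if_true, Finset.mem_sdiff, true_and, mul_one]
        have e : ∑ A, c A * (if a ∉ A then 1 else 0) = S - ∑ A, if a ∈ A then c A else 0 := by
          rw [hS, ← Finset.sum_sub_distrib]
          refine Finset.sum_congr rfl fun A _ => ?_
          by_cases hA : a ∈ A <;> simp [hA]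
        rw [e]
        nlinarith [hc1 a]
      · simp [haU]
    calc _ ≤ ∑ U, P U * ((1 - u) * (if a ∈ U then 1 else 0)) := by
          gcongr with U
          · exact hP0 U
          · exact key U
      _ = (1 - u) * ∑ U, (if a ∈ U then P U else 0) := by
          rw [hind, Finset.mul_sum]
          refine Finset.sum_congr rfl fun U _ => by ring
      _ ≤ (1 - u) * x := by
          by_cases h1 : u ≤ 1
          · exact mul_le_mul_of_nonneg_left (hPx a) (by linarith)
          · exfalso
            have h2 : 1 ≤ S := by
              rw [hS]
              refine (hc1 a).trans (Finset.sum_le_sum fun A _ => ?_)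
              split_ifs
              · exact le_rfl
              · exact hc0 A
            nlinarith
  · rw [hE]
    set κ := x ^ (-(θ / 2)) with hκ
    have hκpos : 0 < κ := Real.rpow_pos_of_pos hx _
    have hκ1 : κ ^ (-(1 / θ)) = x ^ (1 / 2 : ℝ) := by
      rw [hκ, ← Real.rpow_mul hx.le]
      congr 1
      field_simp
    have hκ2 : κ * x = x ^ (1 - θ / 2) := by
      rw [hκ]
      nth_rewrite 2 [← Real.rpow_one x]
      rw [← Real.rpow_add hx]
      congr 1
      ring
    -- the part of `A` outside of `U` has large cost on average, by minimality of the cover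
    have hout : (1 - x) * ∑ A, c A * φ A ≤ ∑ U, ∑ A, P U * c A * φ (A \ U) := by
      have := hmin (fun B => ∑ U, ∑ A, P U * c A * (if A \ U = B then 1 else 0)) (1 - x)
        (fun B => Finset.sum_nonneg fun U _ => Finset.sum_nonneg fun A _ =>
          mul_nonneg (mul_nonneg (hP0 U) (hc0 A)) (by split_ifs <;> simp)) (by linarith) ?_
      · refine this.trans (le_of_eq ?_)
        simp only [Finset.sum_mul]
        rw [Finset.sum_comm]
        refine Finset.sum_congr rfl fun U _ => ?_
        rw [Finset.sum_comm]
        refine Finset.sum_congr rfl fun A _ => ?_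
        simp [mul_assoc]
      · intro a
        have e : ∑ B, (if a ∈ B then ∑ U, ∑ A, P U * c A * (if A \ U = B then 1 else 0) else 0)
            = ∑ U, P U * (1 - if a ∈ U then 1 else 0) * ∑ A, if a ∈ A then c A else 0 := by
          rw [hind]
          simp only [Finset.sum_mul, Finset.mul_sum]
          rw [Finset.sum_comm]
          refine Finset.sum_congr rfl fun U _ => ?_
          rw [Finset.sum_comm]
          refine Finset.sum_congr rfl fun A _ => ?_
          simp only [mul_assoc, ← Finset.mul_sum, ite_mul, one_mul, zero_mul,
            Finset.sum_ite_eq, Finset.mem_univ, if_true, Finset.mem_sdiff]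
          by_cases hA : a ∈ A <;> by_cases hU : a ∈ U <;> simp [hA, hU]
        rw [e]
        calc 1 - x ≤ ∑ U, P U * (1 - if a ∈ U then 1 else 0) := by
              simp only [mul_sub, mul_one, Finset.sum_sub_distrib, hP1, ← hind]
              linarith [hPx a]
          _ ≤ _ := by
              refine Finset.sum_le_sum fun U _ => ?_
              refine le_mul_of_one_le_right (mul_nonneg (hP0 U) ?_) (hc1 a)
              split_ifs <;> simp
    have hpt : ∀ U A : Finset α,
        φ (A ∩ U) ≤ (κ + θ * κ ^ (-(1 / θ))) * φ A - κ * φ (A \ U) := by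
      intro U A
      refine le_of_rpow_add_rpow_le hθ (h.nonneg _) (h.nonneg _) (h.nonneg _) hκpos ?_
      have := h.lower (A ∩ U) (A \ U) (Finset.disjoint_left.2 fun a ha hb => by simp_all)
      rwa [Finset.union_comm, Finset.sdiff_union_inter] at this
    have hin : ∑ U, ∑ A, P U * c A * φ (A ∩ U)
        ≤ (x ^ (1 - θ / 2) + θ * x ^ (1 / 2 : ℝ)) * ∑ A, c A * φ A := by
      calc ∑ U, ∑ A, P U * c A * φ (A ∩ U)
          ≤ ∑ U, ∑ A, P U * c A * ((κ + θ * κ ^ (-(1 / θ))) * φ A - κ * φ (A \ U)) := by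
            gcongr with U _ A _
            · exact mul_nonneg (hP0 U) (hc0 A)
            · exact hpt U A
        _ = (κ + θ * κ ^ (-(1 / θ))) * (∑ U, P U) * ∑ A, c A * φ A
            - κ * ∑ U, ∑ A, P U * c A * φ (A \ U) := by
            simp only [mul_sub, Finset.sum_sub_distrib, Finset.mul_sum, Finset.sum_mul]
            congr 1
            · rw [Finset.sum_comm]
              refine Finset.sum_congr rfl fun _ _ => Finset.sum_congr rfl fun _ _ => by ring
            · refine Finset.sum_congr rfl fun _ _ => Finset.sum_congr rfl fun _ _ => by ring
        _ ≤ (κ + θ * κ ^ (-(1 / θ))) * (∑ U, P U) * ∑ A, c A * φ A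
            - κ * ((1 - x) * ∑ A, c A * φ A) := by gcongr
        _ = _ := by rw [hP1, ← hκ2, hκ1]; ring
    have hsub : ∀ U A : Finset α, φ U ≤ φ (A ∩ U) + φ (U \ A) := by
      intro U A
      have := h.subadd (U ∩ A) (U \ A) (Finset.disjoint_left.2 fun a ha hb => by simp_all)
      rwa [Finset.union_comm, Finset.sdiff_union_inter, Finset.inter_comm] at this
    calc ∑ U, P U * φ U
        = ∑ U, P U * ((1 - u * S) * φ U + u * ∑ A, c A * φ U) := by
          refine Finset.sum_congr rfl fun U _ => ?_
          rw [← Finset.sum_mul, ← hS]; ring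
      _ ≤ ∑ U, P U * ((1 - u * S) * φ U + u * ∑ A, c A * (φ (A ∩ U) + φ (U \ A))) := by
          gcongr with U _ A _
          · exact hP0 U
          · exact hc0 A
          · exact hsub U A
      _ = u * ∑ U, ∑ A, P U * c A * φ (A ∩ U)
          + ∑ U, P U * ((1 - u * S) * φ U + u * ∑ A, c A * φ (U \ A)) := by
          rw [Finset.mul_sum, ← Finset.sum_add_distrib]
          refine Finset.sum_congr rfl fun U _ => ?_
          simp only [mul_add, Finset.sum_add_distrib, mul_assoc, ← Finset.mul_sum]
          ring
      _ ≤ _ := by gcongr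

/-- The sum along the process: with `u` the removal rate, `∑ u (1 - u) ^ (m β) ≤ 1 / β`. -/
lemma _root_.sum_mul_rpow_le {u β : ℝ} (hu : 0 < u) (hu1 : u < 1) (hβ : 0 < β) (hβ1 : β ≤ 1)
    (n : ℕ) : ∑ m ∈ Finset.range n, u * ((1 - u) ^ m) ^ β ≤ 1 / β := by
  have h1 : (1 - u) ^ β ≤ 1 - β * u := by
    have := rpow_one_add_le_one_add_mul_self (s := -u) (by linarith) hβ.le hβ1
    simpa [sub_eq_add_neg] using this
  have h0 : 0 ≤ (1 - u) ^ β := Real.rpow_nonneg (by linarith) _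
  have h2 : (1 - u) ^ β < 1 := by nlinarith
  have h3 : ∀ m : ℕ, ((1 - u) ^ m) ^ β = ((1 - u) ^ β) ^ m := by
    intro m
    rw [← Real.rpow_natCast, ← Real.rpow_natCast, ← Real.rpow_mul (by linarith),
      ← Real.rpow_mul (by linarith), mul_comm]
  simp only [h3, ← Finset.mul_sum]
  have h4 : ∑ m ∈ Finset.range n, ((1 - u) ^ β) ^ m ≤ (1 - (1 - u) ^ β)⁻¹ := by
    rw [← tsum_geometric_of_lt_one h0 h2]
    exact (summable_geometric_of_lt_one h0 h2).sum_le_tsum _ fun _ _ => by positivity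
  calc _ ≤ u * (1 - (1 - u) ^ β)⁻¹ := by gcongr
    _ ≤ u * (β * u)⁻¹ := by
        gcongr
        linarith
    _ = 1 / β := by field_simp

/-- A submeasure with a lower `(1 + θ)`-estimate is nearly dominated by its fractional covers: the
cost of a fractional cover is at least `φ univ`, up to a factor `1 + O(θ)`. -/
theorem le_fractional_cover (h : IsLowerSubmeasure θ φ) (hθ : 0 < θ) (hθ1 : θ ≤ 1)
    {ι : Type*} [Fintype ι] (A : ι → Finset α) (d : ι → ℝ) (hd : ∀ i, 0 ≤ d i)
    (hcov : ∀ a, φ {a} ≠ 0 → 1 ≤ ∑ i, if a ∈ A i then d i else 0) :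
    φ Finset.univ ≤ (1 + 3 * θ) * ∑ i, d i * φ (A i) := by
  classical
  rcases isEmpty_or_nonempty α with he | hne
  · rw [show (Finset.univ : Finset α) = ∅ from Finset.univ_eq_empty, h.empty]
    have : 0 ≤ ∑ i, d i * φ (A i) := Finset.sum_nonneg fun i _ => mul_nonneg (hd i) (h.nonneg _)
    positivity
  obtain ⟨c, hc0, hc1, hmin⟩ := h.exists_min_cover
  set δ := ∑ A, c A * φ A with hδ
  have hδ0 : 0 ≤ δ := Finset.sum_nonneg fun A _ => mul_nonneg (hc0 A) (h.nonneg A)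
  set S := ∑ A, c A with hS
  have hS1 : 1 ≤ S := by
    obtain ⟨a⟩ := hne
    refine (hc1 a).trans (Finset.sum_le_sum fun A _ => ?_)
    split_ifs
    · exact le_rfl
    · exact hc0 A
  set u := 1 / (2 * S) with hu
  have hu0 : 0 < u := by positivity
  have hu1 : u < 1 := by
    rw [hu, div_lt_one (by positivity)]; linarith
  have huS : u * S ≤ 1 := by
    rw [hu]; field_simp; norm_num
  clear_value u S δ
  have hproc : ∀ n : ℕ, ∃ P : Finset α → ℝ, (∀ U, 0 ≤ P U) ∧ ∑ U, P U = 1 ∧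
      (∀ a, ∑ U, (if a ∈ U then P U else 0) ≤ (1 - u) ^ n) ∧
      φ Finset.univ ≤ ∑ m ∈ Finset.range n,
        u * ((((1 - u) ^ m) ^ (1 - θ / 2) + θ * ((1 - u) ^ m) ^ (1 / 2 : ℝ)) * δ)
        + ∑ U, P U * φ U := by
    intro n
    induction n with
    | zero =>
      refine ⟨fun U => if U = Finset.univ then 1 else 0, fun U => by dsimp only; split_ifs <;> simp, by simp,
        fun a => ?_, by simp⟩
      rw [Finset.sum_eq_single Finset.univ] <;> simp +contextual
    | succ n ih =>
      obtain ⟨P, hP0, hP1, hPx, hP⟩ := ih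
      obtain ⟨P', hP0', hP1', hPx', hP'⟩ := h.exists_law_step hθ hc0 hc1 (by rw [← hδ]; exact hmin) hu0.le
        (by rw [← hS]; exact huS)
        (x := (1 - u) ^ n) (pow_pos (by linarith) n)
        (pow_le_one₀ (by linarith) (by linarith)) hP0 hP1 hPx
      refine ⟨P', hP0', hP1', fun a => by rw [pow_succ']; exact hPx' a, ?_⟩
      rw [← hδ] at hP'
      rw [Finset.sum_range_succ]
      linarith
  have hbound : ∀ n : ℕ, φ Finset.univ ≤ (1 + 3 * θ) * δ + (1 - u) ^ n * ∑ a, φ {a} := by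
    intro n
    obtain ⟨P, hP0, hP1, hPx, hP⟩ := hproc n
    have e1 : ∑ m ∈ Finset.range n,
        u * ((((1 - u) ^ m) ^ (1 - θ / 2) + θ * ((1 - u) ^ m) ^ (1 / 2 : ℝ)) * δ)
        = ((∑ m ∈ Finset.range n, u * ((1 - u) ^ m) ^ (1 - θ / 2))
          + θ * ∑ m ∈ Finset.range n, u * ((1 - u) ^ m) ^ (1 / 2 : ℝ)) * δ := by
      rw [Finset.mul_sum, ← Finset.sum_add_distrib, Finset.sum_mul]
      refine Finset.sum_congr rfl fun m _ => by ring
    have e2 := sum_mul_rpow_le hu0 hu1 (β := 1 - θ / 2) (by linarith) (by linarith) n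
    have e3 := sum_mul_rpow_le hu0 hu1 (β := 1 / 2) (by norm_num) (by norm_num) n
    have e4 : 1 / (1 - θ / 2) ≤ 1 + θ := by
      rw [div_le_iff₀ (by linarith)]; nlinarith
    have e5 : ∑ U, P U * φ U ≤ (1 - u) ^ n * ∑ a, φ {a} := by
      calc ∑ U, P U * φ U ≤ ∑ U, P U * ∑ a, (if a ∈ U then φ {a} else 0) := by
            gcongr with U
            · exact hP0 U
            · refine (h.le_sum U).trans (le_of_eq ?_)
              simp
        _ = ∑ a, (∑ U, (if a ∈ U then P U else 0)) * φ {a} := by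
            simp only [Finset.mul_sum, Finset.sum_mul]
            rw [Finset.sum_comm]
            refine Finset.sum_congr rfl fun _ _ => Finset.sum_congr rfl fun _ _ => ?_
            split_ifs <;> simp
        _ ≤ ∑ a, (1 - u) ^ n * φ {a} := by
            gcongr with a
            · exact h.nonneg _
            · exact hPx a
        _ = _ := by rw [Finset.mul_sum]
    rw [e1] at hP
    have e6 : ((∑ m ∈ Finset.range n, u * ((1 - u) ^ m) ^ (1 - θ / 2))
          + θ * ∑ m ∈ Finset.range n, u * ((1 - u) ^ m) ^ (1 / 2 : ℝ)) * δ ≤ (1 + 3 * θ) * δ := by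
      refine mul_le_mul_of_nonneg_right ?_ hδ0
      have : θ * ∑ m ∈ Finset.range n, u * ((1 - u) ^ m) ^ (1 / 2 : ℝ) ≤ θ * (1 / (1 / 2)) := by
        gcongr
      linarith
    linarith
  have hlim : φ Finset.univ ≤ (1 + 3 * θ) * δ := by
    have ht : Filter.Tendsto (fun n : ℕ => (1 + 3 * θ) * δ + (1 - u) ^ n * ∑ a, φ {a})
        Filter.atTop (nhds ((1 + 3 * θ) * δ + 0 * ∑ a, φ {a})) :=
      ((tendsto_pow_atTop_nhds_zero_of_lt_one (by linarith) (by linarith)).mul_const _).const_add _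
    rw [zero_mul, add_zero] at ht
    exact ge_of_tendsto' ht hbound
  refine hlim.trans ?_
  gcongr
  -- complete the family by the set of negligible points, which has no cost
  set Z : Finset α := Finset.univ.filter fun a => φ {a} = 0 with hZ
  have hZ0 : φ Z = 0 := by
    refine le_antisymm ((h.le_sum Z).trans (le_of_eq ?_)) (h.nonneg Z)
    exact Finset.sum_eq_zero fun a ha => (Finset.mem_filter.1 ha).2
  have := hmin (fun B => (∑ i, if A i = B then d i else 0) + if Z = B then 1 else 0) 1 ?_
    zero_le_one ?_
  · rw [one_mul] at this
    refine this.trans (le_of_eq ?_)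
    simp only [add_mul, Finset.sum_add_distrib, Finset.sum_mul, ite_mul, zero_mul, one_mul]
    rw [Finset.sum_comm]
    simp [hZ0]
  · intro B
    refine add_nonneg (Finset.sum_nonneg fun i _ => ?_) ?_
    · split_ifs
      · exact hd i
      · exact le_rfl
    · split_ifs <;> simp
  · intro a
    have e : ∑ B, (if a ∈ B then (∑ i, if A i = B then d i else 0) + (if Z = B then 1 else 0)
        else 0) = (∑ i, if a ∈ A i then d i else 0) + if a ∈ Z then 1 else 0 := by
      have : ∀ B : Finset α, (if a ∈ B then (∑ i, if A i = B then d i else 0)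
          + (if Z = B then 1 else 0) else 0)
          = (∑ i, if A i = B then (if a ∈ A i then d i else 0) else 0)
            + if Z = B then (if a ∈ Z then 1 else 0) else 0 := by
        intro B
        by_cases hB : a ∈ B
        · simp only [hB, if_true]
          congr 1
          · refine Finset.sum_congr rfl fun i _ => ?_
            by_cases hi : A i = B
            · simp [hi, hB]
            · simp [hi]
          · by_cases hi : Z = B
            · simp [hi, hB]
            · simp [hi]
        · simp only [hB, if_false]
          rw [Finset.sum_eq_zero, zero_add]
          · by_cases hi : Z = B
            · simp [hi, hB]
            · simp [hi]
          · intro i _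
            by_cases hi : A i = B
            · simp [hi, hB]
            · simp [hi]
      simp only [this, Finset.sum_add_distrib]
      rw [Finset.sum_comm]
      simp
    rw [e]
    by_cases ha : φ {a} = 0
    · have h1 : 0 ≤ ∑ i, if a ∈ A i then d i else 0 := Finset.sum_nonneg fun i _ => by
        split_ifs
        · exact hd i
        · exact le_rfl
      simp [hZ, ha, h1]
    · simpa [hZ, ha] using hcov a ha

end IsLowerSubmeasure

/-! ### The weight function and the sum over levels -/

/-- The convexity weight of exponent `R < 1`: the part of the tangent-type bound
`(y ^ R - (1 - R)) / R ≤ y` that is needed, relative to `y`. It is at most `1`, it vanishes near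
`0` and it decays at infinity. -/
noncomputable def convexityWeight (R y : ℝ) : ℝ := max 0 ((y ^ R - (1 - R)) / R) / y

lemma convexityWeight_nonneg {R y : ℝ} (hy : 0 < y) : 0 ≤ convexityWeight R y :=
  div_nonneg (le_max_left _ _) hy.le

lemma convexityWeight_le_one {R y : ℝ} (hR : 0 < R) (hR1 : R < 1) (hy : 0 < y) :
    convexityWeight R y ≤ 1 := by
  rw [convexityWeight, div_le_one hy, max_le_iff]
  refine ⟨hy.le, ?_⟩
  rw [div_le_iff₀ hR]
  have := rpow_one_add_le_one_add_mul_self (s := y - 1) (by linarith) hR.le hR1.le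
  rw [add_sub_cancel] at this
  linarith

lemma convexityWeight_le_exp {R y : ℝ} (hR : 0 < R) (hR1 : R < 1) (hy : 0 < y) :
    convexityWeight R y ≤ (1 / R + ((1 - R) ^ (1 / R)) ^ (-(1 - R)))
      * Real.exp (-((1 - R) * |Real.log y|)) := by
  have h1R : 0 < 1 - R := by linarith
  set y₀ := (1 - R) ^ (1 / R) with hy₀
  have hy₀pos : 0 < y₀ := Real.rpow_pos_of_pos h1R _
  rcases le_total 1 y with h1 | h1
  · have e : Real.exp (-((1 - R) * |Real.log y|)) = y ^ R / y := by
      rw [abs_of_nonneg (Real.log_nonneg h1), ← Real.rpow_sub_one hy.ne',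
        Real.rpow_def_of_pos hy]
      congr 1; ring
    rw [e, convexityWeight]
    have hyR : 0 < y ^ R := Real.rpow_pos_of_pos hy _
    have h2 : max 0 ((y ^ R - (1 - R)) / R) ≤ 1 / R * y ^ R := by
      refine max_le (by positivity) ?_
      rw [div_le_iff₀ hR]
      field_simp
      linarith
    rw [← mul_div_assoc]
    gcongr
    refine h2.trans ?_
    gcongr
    have : 0 < y₀ ^ (-(1 - R)) := Real.rpow_pos_of_pos hy₀pos _
    linarith
  · rcases le_or_gt (y ^ R) (1 - R) with h2 | h2
    · have : convexityWeight R y = 0 := by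
        rw [convexityWeight, max_eq_left, zero_div]
        exact div_nonpos_of_nonpos_of_nonneg (by linarith) hR.le
      rw [this]
      positivity
    · have h3 : y₀ ≤ y := by
        calc y₀ ≤ (y ^ R) ^ (1 / R) := by
              apply Real.rpow_le_rpow h1R.le h2.le (by positivity)
          _ = y := by rw [← Real.rpow_mul hy.le, mul_one_div_cancel hR.ne', Real.rpow_one]
      have e : Real.exp (-((1 - R) * |Real.log y|)) = y ^ (1 - R) := by
        rw [abs_of_nonpos (Real.log_nonpos hy.le h1), Real.rpow_def_of_pos hy]
        congr 1; ring
      rw [e]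
      refine (convexityWeight_le_one hR hR1 hy).trans ?_
      have h4 : 1 ≤ y₀ ^ (-(1 - R)) * y ^ (1 - R) := by
        rw [Real.rpow_neg hy₀pos.le, inv_mul_eq_div,
          one_le_div (Real.rpow_pos_of_pos hy₀pos _)]
        exact Real.rpow_le_rpow hy₀pos.le h3 h1R.le
      have h5 : 0 < y ^ (1 - R) := Real.rpow_pos_of_pos hy _
      have h6 : 0 < 1 / R * y ^ (1 - R) := by positivity
      rw [add_mul]
      linarith

/-- A geometric sum in disguise: if `g` is injective then `∑ q ^ g k ≤ (1 - q)⁻¹`. -/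
lemma sum_pow_injOn_le {ι : Type*} (s : Finset ι) (g : ι → ℕ) (hg : Set.InjOn g s) {q : ℝ}
    (hq : 0 ≤ q) (hq1 : q < 1) : ∑ k ∈ s, q ^ g k ≤ (1 - q)⁻¹ := by
  classical
  rw [← Finset.sum_image (f := fun j => q ^ j) hg, ← tsum_geometric_of_lt_one hq hq1]
  exact (summable_geometric_of_lt_one hq hq1).sum_le_tsum _ fun _ _ => by positivity

lemma sum_exp_neg_abs_le {β θ : ℝ} (hβ : 0 < β) (hθ : 0 < θ) (hθ1 : θ ≤ 1) (σ : ℝ) (m : ℕ) :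
    ∑ k ∈ Finset.range m, Real.exp (-(β * |k * θ + σ|)) ≤ 2 * (1 + 1 / β) / θ := by
  set q := Real.exp (-(β * θ)) with hq
  have hq0 : 0 ≤ q := (Real.exp_pos _).le
  have hq1 : q < 1 := by rw [hq, Real.exp_lt_one_iff]; nlinarith
  have hgeo : (1 - q)⁻¹ ≤ (1 + 1 / β) / θ := by
    have h1 : q ≤ 1 / (1 + β * θ) := by
      rw [hq, Real.exp_neg, ← one_div]
      exact one_div_le_one_div_of_le (by positivity) (by linarith [Real.add_one_le_exp (β * θ)])
    rw [inv_le_comm₀ (by linarith) (by positivity)]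
    have h2 : ((1 + 1 / β) / θ)⁻¹ = β * θ / (1 + β) := by field_simp; ring
    have h3 : β * θ / (1 + β) ≤ β * θ / (1 + β * θ) := by
      apply div_le_div_of_nonneg_left (by positivity) (by positivity)
      nlinarith
    have h4 : 1 - 1 / (1 + β * θ) = β * θ / (1 + β * θ) := by field_simp; ring
    rw [h2]
    linarith
  -- on either side of the zero of `k θ + σ` the floors of `|k θ + σ| / θ` are distinct
  have hterm : ∀ z : ℝ, 0 ≤ z → Real.exp (-(β * (z * θ))) ≤ q ^ ⌊z⌋₊ := by
    intro z hz
    rw [hq, ← Real.exp_nat_mul]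
    apply Real.exp_le_exp.2
    have := Nat.floor_le hz
    nlinarith [mul_le_mul_of_nonneg_left this (mul_pos hβ hθ).le]
  rw [← Finset.sum_filter_add_sum_filter_not _ (fun k : ℕ => 0 ≤ (k : ℝ) + σ / θ)]
  have hpos : ∑ k ∈ (Finset.range m).filter (fun k : ℕ => 0 ≤ (k : ℝ) + σ / θ),
      Real.exp (-(β * |k * θ + σ|)) ≤ (1 - q)⁻¹ := by
    refine (Finset.sum_le_sum fun k hk => ?_).trans
      (sum_pow_injOn_le _ (fun k : ℕ => ⌊(k : ℝ) + σ / θ⌋₊) ?_ hq0 hq1)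
    · have hk' := (Finset.mem_filter.1 hk).2
      refine le_trans (le_of_eq ?_) (hterm _ hk')
      have e : (k : ℝ) * θ + σ = (k + σ / θ) * θ := by field_simp
      rw [e, abs_of_nonneg (by positivity)]
    · intro k hk l hl hkl
      have hk' := (Finset.mem_filter.1 hk).2
      have hl' := (Finset.mem_filter.1 hl).2
      simp only at hkl
      have a1 := Nat.floor_le hk'
      have a2 := Nat.floor_le hl'
      have a3 := Nat.lt_floor_add_one ((k : ℝ) + σ / θ)
      have a4 := Nat.lt_floor_add_one ((l : ℝ) + σ / θ)
      rw [hkl] at a1 a3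
      have b1 : (k : ℝ) < l + 1 := by linarith
      have b2 : (l : ℝ) < k + 1 := by linarith
      norm_cast at b1 b2
      omega
  have hneg : ∑ k ∈ (Finset.range m).filter (fun k : ℕ => ¬ 0 ≤ (k : ℝ) + σ / θ),
      Real.exp (-(β * |k * θ + σ|)) ≤ (1 - q)⁻¹ := by
    refine (Finset.sum_le_sum fun k hk => ?_).trans
      (sum_pow_injOn_le _ (fun k : ℕ => ⌊-((k : ℝ) + σ / θ)⌋₊) ?_ hq0 hq1)
    · have hk' := (Finset.mem_filter.1 hk).2
      push Not at hk'
      refine le_trans (le_of_eq ?_) (hterm _ (by linarith : 0 ≤ -((k : ℝ) + σ / θ)))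
      have e : (k : ℝ) * θ + σ = (k + σ / θ) * θ := by field_simp
      rw [e, abs_of_nonpos (by nlinarith)]
      congr 2; ring
    · intro k hk l hl hkl
      have hk' := (Finset.mem_filter.1 hk).2
      have hl' := (Finset.mem_filter.1 hl).2
      push Not at hk' hl'
      simp only at hkl
      have a1 := Nat.floor_le (by linarith : 0 ≤ -((k : ℝ) + σ / θ))
      have a2 := Nat.floor_le (by linarith : 0 ≤ -((l : ℝ) + σ / θ))
      have a3 := Nat.lt_floor_add_one (-((k : ℝ) + σ / θ))
      have a4 := Nat.lt_floor_add_one (-((l : ℝ) + σ / θ))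
      rw [hkl] at a1 a3
      have b1 : (k : ℝ) < l + 1 := by linarith
      have b2 : (l : ℝ) < k + 1 := by linarith
      norm_cast at b1 b2
      omega
  calc _ ≤ (1 + 1 / β) / θ + (1 + 1 / β) / θ := by linarith
    _ = _ := by ring

/-- A sum over the levels `exp (-(k θ + σ))`, with convexity weights, costs only a factor
`(C / θ) ^ θ` compared with the `ℓ_{1 + θ}`-norm: about `C / θ` levels carry the weight. -/
lemma exists_sum_mul_convexityWeight_le {R : ℝ} (hR : 0 < R) (hR1 : R < 1) :
    ∃ C : ℝ, 1 ≤ C ∧ ∀ (θ σ T : ℝ) (m : ℕ) (x : ℕ → ℝ), 0 < θ → θ < 1 → 0 ≤ T →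
      (∀ k, 0 ≤ x k) → ∑ k ∈ Finset.range m, x k ^ (1 + θ) ≤ T ^ (1 + θ) →
      ∑ k ∈ Finset.range m, x k * convexityWeight R (Real.exp (-(k * θ + σ)))
        ≤ (C / θ) ^ θ * T := by
  set D := 1 / R + ((1 - R) ^ (1 / R)) ^ (-(1 - R)) with hD
  have h1R : 0 < 1 - R := by linarith
  have hD0 : 0 ≤ D := by positivity
  refine ⟨D * (2 * (1 + 1 / (1 - R))) + 1, ?_, ?_⟩
  · have : 0 ≤ D * (2 * (1 + 1 / (1 - R))) := by positivity
    linarith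
  intro θ σ T m x hθ hθ1 hT hx hxT
  set C := D * (2 * (1 + 1 / (1 - R))) + 1 with hC
  have hC1 : 1 ≤ C := by
    have : 0 ≤ D * (2 * (1 + 1 / (1 - R))) := by positivity
    linarith
  have hpq : (1 + θ).HolderConjugate ((1 + θ) / θ) := by
    rw [Real.holderConjugate_iff]
    refine ⟨by linarith, ?_⟩
    field_simp
  have hw0 : ∀ k : ℕ, 0 ≤ convexityWeight R (Real.exp (-(k * θ + σ))) :=
    fun k => convexityWeight_nonneg (Real.exp_pos _)
  have hw1 : ∀ k : ℕ, convexityWeight R (Real.exp (-(k * θ + σ))) ≤ 1 :=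
    fun k => convexityWeight_le_one hR hR1 (Real.exp_pos _)
  have H := Real.inner_le_Lp_mul_Lq_of_nonneg (Finset.range m) hpq (fun k _ => hx k)
    (fun k _ => hw0 k)
  refine H.trans ?_
  have h1 : (∑ k ∈ Finset.range m, x k ^ (1 + θ)) ^ (1 / (1 + θ)) ≤ T := by
    calc _ ≤ (T ^ (1 + θ)) ^ (1 / (1 + θ)) :=
          Real.rpow_le_rpow (Finset.sum_nonneg fun k _ => Real.rpow_nonneg (hx k) _) hxT
            (by positivity)
      _ = T := by rw [← Real.rpow_mul hT, mul_one_div_cancel (by positivity), Real.rpow_one]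
  have h2 : ∑ k ∈ Finset.range m,
      convexityWeight R (Real.exp (-(k * θ + σ))) ^ ((1 + θ) / θ) ≤ C / θ := by
    calc _ ≤ ∑ k ∈ Finset.range m, D * Real.exp (-((1 - R) * |k * θ + σ|)) := by
          refine Finset.sum_le_sum fun k _ => ?_
          refine (Real.rpow_le_self_of_le_one (hw0 k) (hw1 k) (by rw [le_div_iff₀ hθ]; linarith)).trans ?_
          have := convexityWeight_le_exp hR hR1 (Real.exp_pos (-((k : ℝ) * θ + σ)))
          rwa [Real.log_exp, abs_neg] at this
      _ ≤ D * (2 * (1 + 1 / (1 - R)) / θ) := by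
          rw [← Finset.mul_sum]
          exact mul_le_mul_of_nonneg_left (sum_exp_neg_abs_le h1R hθ hθ1.le σ m) hD0
      _ ≤ C / θ := by
          rw [← mul_div_assoc]
          gcongr
          linarith
  have h3 : (∑ k ∈ Finset.range m,
      convexityWeight R (Real.exp (-(k * θ + σ))) ^ ((1 + θ) / θ)) ^ (1 / ((1 + θ) / θ))
      ≤ (C / θ) ^ θ := by
    calc _ ≤ (C / θ) ^ (1 / ((1 + θ) / θ)) :=
          Real.rpow_le_rpow (Finset.sum_nonneg fun k _ => Real.rpow_nonneg (hw0 k) _) h2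
            (by positivity)
      _ ≤ (C / θ) ^ θ := by
          apply Real.rpow_le_rpow_of_exponent_le
          · rw [le_div_iff₀ hθ]; linarith
          · rw [one_div_div, div_le_iff₀ (by positivity)]; nlinarith
  calc _ ≤ T * (C / θ) ^ θ :=
        mul_le_mul h1 h3 (Real.rpow_nonneg (Finset.sum_nonneg fun k _ =>
          Real.rpow_nonneg (hw0 k) _) _) hT
    _ = _ := mul_comm _ _

/-! ### The convexity estimate on a finite algebra of level sets -/

/-- The convexity estimate in combinatorial form. A point `a` records the levels `a i` of `n`
functions relative to the total function: the `i`-th function is about `exp (-θ (a i + 1))` there,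
and it counts as zero at the last level `m`. -/
theorem IsLowerSubmeasure.univ_le_of_levels {R C θ : ℝ} (hR : 0 < R) (hR1 : R < 1) (hθ : 0 < θ)
    (hθ1 : θ < 1)
    (hC : ∀ (σ T : ℝ) (m : ℕ) (x : ℕ → ℝ), 0 ≤ T → (∀ k, 0 ≤ x k) →
      ∑ k ∈ Finset.range m, x k ^ (1 + θ) ≤ T ^ (1 + θ) →
      ∑ k ∈ Finset.range m, x k * convexityWeight R (Real.exp (-(k * θ + σ))) ≤ (C / θ) ^ θ * T)
    {n m : ℕ} {φ : Finset (Fin n → Fin (m + 1)) → ℝ} (h : IsLowerSubmeasure θ φ)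
    (τ : Fin n → ℝ) (hτ0 : ∀ i, 0 < τ i)
    (hτ : ∀ i, ∑ k ∈ Finset.range m, (Real.exp (-(θ * (k + 1))) *
      φ (Finset.univ.filter fun a => (a i : ℕ) = k)) ^ (1 + θ) ≤ τ i ^ (1 + θ))
    (hcov : ∀ a, φ {a} ≠ 0 → Real.exp (-(2 * θ * R)) ≤
      ∑ i, (if (a i : ℕ) < m then Real.exp (-(θ * ((a i : ℕ) + 1))) else 0) ^ R) :
    φ Finset.univ ≤ (1 + 3 * θ) * (Real.exp (2 * θ) * (C / θ) ^ θ * (∑ i, τ i ^ R) ^ (1 / R)) := by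
  rcases Nat.eq_zero_or_pos n with rfl | hn
  · have : φ Finset.univ ≤ 0 := by
      refine (h.le_sum _).trans (le_of_eq (Finset.sum_eq_zero fun a _ => ?_))
      by_contra hne
      have := hcov a hne
      simp only [Finset.univ_eq_empty, Finset.sum_empty] at this
      exact absurd (Real.exp_pos _) (not_lt.2 this)
    simpa [Real.zero_rpow, hR.ne'] using this
  have : Nonempty (Fin n) := ⟨⟨0, hn⟩⟩
  set Z := (∑ i, τ i ^ R) ^ (1 / R) with hZ
  have hsum0 : 0 < ∑ i, τ i ^ R :=
    Finset.sum_pos (fun i _ => Real.rpow_pos_of_pos (hτ0 i) _) Finset.univ_nonempty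
  have hZ0 : 0 < Z := Real.rpow_pos_of_pos hsum0 _
  have hZR : Z ^ R = ∑ i, τ i ^ R := by
    rw [hZ, ← Real.rpow_mul hsum0.le, one_div_mul_cancel hR.ne', Real.rpow_one]
  set s : Fin n → ℝ := fun i => τ i / Z with hs
  have hs0 : ∀ i, 0 < s i := fun i => div_pos (hτ0 i) hZ0
  have hs1 : ∑ i, s i ^ R = 1 := by
    simp only [hs, Real.div_rpow (hτ0 _).le hZ0.le, ← Finset.sum_div, hZR]
    exact div_self hsum0.ne'
  -- the level `k` of the `i`-th function, relative to `s i`; the factor `exp (2 θ)` makes up for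
  -- the rounding of the levels
  set y : Fin n → ℕ → ℝ := fun i k => Real.exp (-(k * θ + (Real.log (s i) - θ))) with hy
  have hys : ∀ i (k : ℕ), s i * y i k = Real.exp (2 * θ) * Real.exp (-(θ * (k + 1))) := by
    intro i k
    simp only [hy]
    nth_rewrite 1 [← Real.exp_log (hs0 i)]
    rw [← Real.exp_add, ← Real.exp_add]
    congr 1; ring
  have hy0 : ∀ i k, 0 < y i k := fun i k => Real.exp_pos _
  have hmax : ∀ i k, 0 ≤ y i k * convexityWeight R (y i k) := fun i k =>
    mul_nonneg (hy0 i k).le (convexityWeight_nonneg (hy0 i k))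
  have key := h.le_fractional_cover hθ hθ1.le (ι := Fin n × Fin m)
    (fun ik => Finset.univ.filter fun a => (a ik.1 : ℕ) = ik.2)
    (fun ik => s ik.1 ^ R * (y ik.1 ik.2 * convexityWeight R (y ik.1 ik.2)))
    (fun ik => mul_nonneg (Real.rpow_nonneg (hs0 _).le _) (hmax _ _)) ?_
  · refine key.trans ?_
    refine mul_le_mul_of_nonneg_left ?_ (by positivity)
    rw [Fintype.sum_prod_type]
    calc ∑ i, ∑ k : Fin m, s i ^ R * (y i k * convexityWeight R (y i k))
          * φ (Finset.univ.filter fun a => (a i : ℕ) = k)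
        = ∑ i, s i ^ R * (Real.exp (2 * θ) / s i) * ∑ k ∈ Finset.range m,
            (Real.exp (-(θ * (k + 1))) * φ (Finset.univ.filter fun a => (a i : ℕ) = k))
              * convexityWeight R (y i k) := by
          refine Finset.sum_congr rfl fun i _ => ?_
          rw [Finset.mul_sum, Finset.sum_range]
          refine Finset.sum_congr rfl fun k _ => ?_
          have e : y i k = Real.exp (2 * θ) / s i * Real.exp (-(θ * ((k : ℕ) + 1))) := by
            rw [div_mul_eq_mul_div, eq_div_iff (hs0 i).ne', mul_comm, hys]
          calc _ = s i ^ R * y i k * convexityWeight R (y i k)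
                * φ (Finset.univ.filter fun a => (a i : ℕ) = k) := by ring
            _ = _ := by
              nth_rewrite 1 [e]
              ring
      _ ≤ ∑ i, s i ^ R * (Real.exp (2 * θ) / s i) * ((C / θ) ^ θ * τ i) := by
          refine Finset.sum_le_sum fun i _ => mul_le_mul_of_nonneg_left ?_ ?_
          · exact hC _ _ _ _ (hτ0 i).le
              (fun k => mul_nonneg (Real.exp_pos _).le (h.nonneg _)) (hτ i)
          · have := hs0 i
            positivity
      _ = ∑ i, s i ^ R * (Real.exp (2 * θ) * (C / θ) ^ θ * Z) := by
          refine Finset.sum_congr rfl fun i _ => ?_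
          have := hτ0 i
          simp only [hs]
          field_simp
      _ = _ := by rw [← Finset.sum_mul, hs1, one_mul]
  · intro a ha
    have hpt : ∀ i, (Real.exp (2 * θ * R) *
        (if (a i : ℕ) < m then Real.exp (-(θ * ((a i : ℕ) + 1))) else 0) ^ R
          - (1 - R) * s i ^ R) / R ≤ ∑ k : Fin m, if (a i : ℕ) = k then
            s i ^ R * (y i k * convexityWeight R (y i k)) else 0 := by
      intro i
      by_cases hi : (a i : ℕ) < m
      · rw [Finset.sum_eq_single (⟨a i, hi⟩ : Fin m)]
        · simp only [hi, if_true]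
          have e1 : y i (a i) * convexityWeight R (y i (a i))
              = max 0 ((y i (a i) ^ R - (1 - R)) / R) := by
            rw [convexityWeight, mul_div_cancel₀ _ (hy0 _ _).ne']
          have e2 : Real.exp (2 * θ * R) * Real.exp (-(θ * ((a i : ℕ) + 1))) ^ R
              = s i ^ R * y i (a i) ^ R := by
            rw [← Real.mul_rpow (hs0 i).le (hy0 _ _).le, hys,
              Real.mul_rpow (Real.exp_pos _).le (Real.exp_pos _).le, Real.exp_mul]
          rw [e1, e2]
          calc _ = s i ^ R * ((y i (a i) ^ R - (1 - R)) / R) := by ring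
            _ ≤ _ := mul_le_mul_of_nonneg_left (le_max_right _ _) (Real.rpow_nonneg (hs0 i).le _)
        · intro k _ hk
          rw [if_neg]
          intro h'
          exact hk (Fin.ext h'.symm)
        · simp
      · rw [Finset.sum_eq_zero]
        · simp only [hi, if_false, Real.zero_rpow hR.ne', mul_zero, zero_sub]
          refine div_nonpos_of_nonpos_of_nonneg ?_ hR.le
          have := Real.rpow_nonneg (hs0 i).le R
          nlinarith
        · intro k _
          rw [if_neg]
          have := k.2
          omega
    have hsum : ∑ ik : Fin n × Fin m, (if a ∈ Finset.univ.filter (fun a : Fin n → Fin (m + 1) =>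
          (a ik.1 : ℕ) = ik.2) then s ik.1 ^ R * (y ik.1 ik.2 * convexityWeight R (y ik.1 ik.2))
          else 0) = ∑ i, ∑ k : Fin m, if (a i : ℕ) = k then
            s i ^ R * (y i k * convexityWeight R (y i k)) else 0 := by
      rw [Fintype.sum_prod_type]
      simp
    rw [hsum]
    refine le_trans ?_ (Finset.sum_le_sum fun i _ => hpt i)
    rw [← Finset.sum_div, Finset.sum_sub_distrib, ← Finset.mul_sum, ← Finset.mul_sum, hs1,
      le_div_iff₀ hR]
    have e3 : (1 : ℝ) = Real.exp (2 * θ * R) * Real.exp (-(2 * θ * R)) := by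
      rw [← Real.exp_add]; simp
    have := mul_le_mul_of_nonneg_left (hcov a ha) (Real.exp_pos (2 * θ * R)).le
    rw [← e3] at this
    linarith

/-! ### Elementary facts on admissible quasinorms -/

section Quasinorm

variable {Ω : Type*} [MeasurableSpace Ω] {N : (Ω → ℝ) → ℝ≥0∞}

lemma IsAdmissibleQuasinorm.map_zero (h : IsAdmissibleQuasinorm N) : N (fun _ => 0) = 0 := by
  have := h.smul 0 (fun _ => 0) measurable_const
  simpa using this

lemma IsAdmissibleQuasinorm.memSpace_of_le (h : IsAdmissibleQuasinorm N) {f g : Ω → ℝ}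
    (hf : Measurable f) (hg : MemSpace N g) (hfg : ∀ x, |f x| ≤ |g x|) : MemSpace N f :=
  ⟨hf, (h.mono f g hf hg.1 hfg).trans_lt hg.2⟩

lemma IsAdmissibleQuasinorm.memSpace_const_mul (h : IsAdmissibleQuasinorm N) {f : Ω → ℝ}
    (hf : MemSpace N f) (c : ℝ) : MemSpace N fun x => c * f x :=
  ⟨hf.1.const_mul c, by rw [h.smul c f hf.1]; exact ENNReal.mul_lt_top (by simp) hf.2⟩

/-- The space is closed under addition: `|f| + |g|` is at most twice the larger of the two, which
is a disjoint sum. -/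
lemma IsAdmissibleQuasinorm.memSpace_abs_add_abs (h : IsAdmissibleQuasinorm N) {f g : Ω → ℝ}
    (hf : MemSpace N f) (hg : MemSpace N g) : MemSpace N fun x => |f x| + |g x| := by
  obtain ⟨C, hC⟩ := h.quasi_add
  set S : Set Ω := {x | |g x| ≤ |f x|} with hS
  have hSm : MeasurableSet S := measurableSet_le hg.1.abs hf.1.abs
  set f' := S.indicator fun x => |f x| with hf'
  set g' := Sᶜ.indicator fun x => |g x| with hg'
  have mf' : MemSpace N f' := h.memSpace_of_le (hf.1.abs.indicator hSm) hf fun x => by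
    by_cases hx : x ∈ S <;> simp [hf', hx]
  have mg' : MemSpace N g' := h.memSpace_of_le (hg.1.abs.indicator hSm.compl) hg fun x => by
    by_cases hx : x ∈ S <;> simp [hg', hx]
  have hsum : MemSpace N fun x => f' x + g' x := by
    refine ⟨mf'.1.add mg'.1, (hC f' g' mf'.1 mg'.1 ?_ ?_ ?_).trans_lt ?_⟩
    · exact fun x => Set.indicator_nonneg (fun _ _ => abs_nonneg _) x
    · exact fun x => Set.indicator_nonneg (fun _ _ => abs_nonneg _) x
    · exact (disjoint_compl_right (a := S)).mono Set.support_indicator_subset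
        Set.support_indicator_subset
    · exact ENNReal.mul_lt_top ENNReal.ofReal_lt_top (ENNReal.add_lt_top.2 ⟨mf'.2, mg'.2⟩)
  refine h.memSpace_of_le (hf.1.abs.add hg.1.abs) (h.memSpace_const_mul hsum 2) fun x => ?_
  rw [abs_of_nonneg (by positivity)]
  refine le_trans ?_ (le_abs_self _)
  by_cases hx : x ∈ S
  · have : |g x| ≤ |f x| := hx
    simp [hf', hg', hx]
    linarith
  · have : ¬ |g x| ≤ |f x| := hx
    simp [hf', hg', hx]
    linarith

lemma IsAdmissibleQuasinorm.memSpace_sum_abs (h : IsAdmissibleQuasinorm N) {n : ℕ}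
    {f : Fin n → Ω → ℝ} (hf : ∀ i, MemSpace N (f i)) : MemSpace N fun x => ∑ i, |f i x| := by
  induction n with
  | zero =>
    refine ⟨Finset.measurable_sum _ fun i _ => (hf i).1.abs, ?_⟩
    simp [h.map_zero]
  | succ n ih =>
    have := h.memSpace_abs_add_abs (hf 0) (ih fun i => hf i.succ)
    refine h.memSpace_of_le (Finset.measurable_sum _ fun i _ => (hf i).1.abs) this fun x => ?_
    rw [Fin.sum_univ_succ, abs_of_nonneg (a := ∑ i : Fin n, |f i.succ x|)
      (Finset.sum_nonneg fun _ _ => abs_nonneg _)]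

lemma IsAdmissibleQuasinorm.memSpace_rpow_sum (h : IsAdmissibleQuasinorm N) {r : ℝ} (hr : 0 < r)
    {n : ℕ} {f : Fin n → Ω → ℝ} (hf : ∀ i, MemSpace N (f i)) :
    MemSpace N fun x => (∑ i, |f i x| ^ r) ^ (1 / r) := by
  have hm : Measurable fun x => (∑ i, |f i x| ^ r) ^ (1 / r) :=
    (Finset.measurable_sum _ fun i _ => (hf i).1.abs.pow_const r).pow_const _
  refine h.memSpace_of_le hm
    (h.memSpace_const_mul (h.memSpace_sum_abs hf) ((n : ℝ) ^ (1 / r))) fun x => ?_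
  have h0 : 0 ≤ ∑ i, |f i x| ^ r := Finset.sum_nonneg fun _ _ => Real.rpow_nonneg (abs_nonneg _) _
  have h1 : 0 ≤ ∑ i, |f i x| := Finset.sum_nonneg fun _ _ => abs_nonneg _
  rw [abs_of_nonneg (Real.rpow_nonneg h0 _), abs_of_nonneg (by positivity)]
  calc (∑ i, |f i x| ^ r) ^ (1 / r) ≤ (∑ _i : Fin n, (∑ j, |f j x|) ^ r) ^ (1 / r) := by
        refine Real.rpow_le_rpow h0 (Finset.sum_le_sum fun i _ => ?_) (by positivity)
        refine Real.rpow_le_rpow (abs_nonneg _) ?_ hr.le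
        exact Finset.single_le_sum (f := fun j => |f j x|) (fun _ _ => abs_nonneg _)
          (Finset.mem_univ i)
    _ = _ := by
        rw [Finset.sum_const, Finset.card_univ, Fintype.card_fin, nsmul_eq_mul,
          Real.mul_rpow (by positivity) (by positivity), ← Real.rpow_mul h1,
          mul_one_div_cancel hr.ne', Real.rpow_one]

lemma UpperEstimate.add_le {p : ℝ} (hp : 0 < p) (h : UpperEstimate N p) {f g : Ω → ℝ}
    (hf : MemSpace N f) (hg : MemSpace N g)
    (hd : Disjoint (Function.support f) (Function.support g)) :
    N (fun x => f x + g x) ^ p ≤ N f ^ p + N g ^ p := by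
  have := h 2 ![f, g] (fun i => by fin_cases i <;> simpa) (fun i j hij => by
    fin_cases i <;> fin_cases j <;> simp_all [disjoint_comm])
  simp only [Fin.sum_univ_two, Matrix.cons_val_zero, Matrix.cons_val_one] at this
  calc _ ≤ ((N f ^ p + N g ^ p) ^ (1 / p)) ^ p := ENNReal.rpow_le_rpow this hp.le
    _ = _ := by rw [← ENNReal.rpow_mul, one_div_mul_cancel hp.ne', ENNReal.rpow_one]

lemma LowerEstimate.sum_le {q : ℝ} (hq : 0 < q) (h : LowerEstimate N q) {n : ℕ}
    {f : Fin n → Ω → ℝ} (hf : ∀ i, MemSpace N (f i))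
    (hd : Pairwise fun i j => Disjoint (Function.support (f i)) (Function.support (f j))) :
    ∑ i, N (f i) ^ q ≤ N (fun x => ∑ i, f i x) ^ q := by
  have := ENNReal.rpow_le_rpow (h n f hf hd) hq.le
  rwa [← ENNReal.rpow_mul, one_div_mul_cancel hq.ne', ENNReal.rpow_one] at this

lemma LowerEstimate.add_le {q : ℝ} (hq : 0 < q) (h : LowerEstimate N q) {f g : Ω → ℝ}
    (hf : MemSpace N f) (hg : MemSpace N g)
    (hd : Disjoint (Function.support f) (Function.support g)) :
    N f ^ q + N g ^ q ≤ N (fun x => f x + g x) ^ q := by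
  have := h.sum_le hq (f := ![f, g]) (fun i => by fin_cases i <;> simpa) (fun i j hij => by
    fin_cases i <;> fin_cases j <;> simp_all [disjoint_comm])
  simpa only [Fin.sum_univ_two, Matrix.cons_val_zero, Matrix.cons_val_one] using this

/-- Lower estimates become weaker as the exponent grows. -/
lemma LowerEstimate.mono {q q' : ℝ} (hq : 0 < q) (hqq : q ≤ q') (h : LowerEstimate N q) :
    LowerEstimate N q' := by
  intro n f hf hd
  refine le_trans ?_ (h n f hf hd)
  have hq' : 0 < q' := hq.trans_le hqq
  set S := ∑ i, N (f i) ^ q with hS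
  have h1 : ∑ i, N (f i) ^ q' ≤ S ^ (q' / q) := by
    have : ∀ i, N (f i) ^ q' = (N (f i) ^ q) ^ (q' / q) := fun i => by
      rw [← ENNReal.rpow_mul]; congr 1; field_simp
    simp only [this]
    have hs : (1 : ℝ) ≤ q' / q := by rwa [one_le_div hq]
    rw [hS]
    generalize (Finset.univ : Finset (Fin n)) = s
    induction s using Finset.cons_induction with
    | empty => simp
    | cons a s ha ih =>
      rw [Finset.sum_cons, Finset.sum_cons]
      exact (add_le_add_right ih _).trans (ENNReal.add_rpow_le_rpow_add _ _ hs)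
  calc _ ≤ (S ^ (q' / q)) ^ (1 / q') := ENNReal.rpow_le_rpow h1 (by positivity)
    _ = _ := by rw [← ENNReal.rpow_mul]; congr 1; field_simp

/-- On a finite algebra of sets, given by a label `l`, the restrictions of a function to the sets
of the algebra define a submeasure with a lower estimate. -/
lemma isLowerSubmeasure_restrict (h : IsAdmissibleQuasinorm N) {p θ : ℝ} (hp : 0 < p)
    (hθ : 0 < θ) (hU : UpperEstimate N p) (hL : LowerEstimate N (p * (1 + θ)))
    {α : Type*} [DecidableEq α] [MeasurableSpace α] [DiscreteMeasurableSpace α]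
    {l : Ω → α} (hl : Measurable l) {F : Ω → ℝ} (hF : MemSpace N F) :
    IsLowerSubmeasure θ fun A : Finset α =>
      (N ((l ⁻¹' (A : Set α)).indicator F) ^ p).toReal := by
  have hmeas : ∀ A : Finset α, MeasurableSet (l ⁻¹' (A : Set α)) := fun A => hl .of_discrete
  have hmem : ∀ A : Finset α, MemSpace N ((l ⁻¹' (A : Set α)).indicator F) := fun A =>
    h.memSpace_of_le (hF.1.indicator (hmeas A)) hF fun x => by
      by_cases hx : x ∈ l ⁻¹' (A : Set α)
      · rw [Set.indicator_of_mem hx]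
      · rw [Set.indicator_of_notMem hx]; simp
  have hfin : ∀ A : Finset α, N ((l ⁻¹' (A : Set α)).indicator F) ^ p ≠ ∞ := fun A =>
    (ENNReal.rpow_lt_top_of_nonneg hp.le (hmem A).2.ne).ne
  have hdisj : ∀ A B : Finset α, Disjoint A B →
      Disjoint (l ⁻¹' (A : Set α)) (l ⁻¹' (B : Set α)) := fun A B hAB =>
    Disjoint.preimage l (by exact_mod_cast hAB)
  have hadd : ∀ A B : Finset α, Disjoint A B →
      ((l ⁻¹' ((A ∪ B : Finset α) : Set α)).indicator F)
        = fun x => (l ⁻¹' (A : Set α)).indicator F x + (l ⁻¹' (B : Set α)).indicator F x := by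
    intro A B hAB
    rw [Finset.coe_union, Set.preimage_union, Set.indicator_union_of_disjoint (hdisj A B hAB)]
  have hsupp : ∀ A B : Finset α, Disjoint A B →
      Disjoint (Function.support ((l ⁻¹' (A : Set α)).indicator F))
        (Function.support ((l ⁻¹' (B : Set α)).indicator F)) := fun A B hAB =>
    (hdisj A B hAB).mono Set.support_indicator_subset Set.support_indicator_subset
  refine ⟨fun A => ENNReal.toReal_nonneg, fun A B hAB => ?_, fun A B hAB => ?_⟩
  · rw [← ENNReal.toReal_add (hfin A) (hfin B), hadd A B hAB]
    exact ENNReal.toReal_mono (ENNReal.add_ne_top.2 ⟨hfin A, hfin B⟩)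
      (hU.add_le hp (hmem A) (hmem B) (hsupp A B hAB))
  · have h1 : (0 : ℝ) ≤ 1 + θ := by linarith
    have hfin' : ∀ A : Finset α, (N ((l ⁻¹' (A : Set α)).indicator F) ^ p) ^ (1 + θ) ≠ ∞ :=
      fun A => (ENNReal.rpow_lt_top_of_nonneg h1 (hfin A)).ne
    simp only [ENNReal.toReal_rpow (_ ^ p)]
    rw [← ENNReal.toReal_add (hfin' A) (hfin' B)]
    refine ENNReal.toReal_mono (hfin' _) ?_
    rw [hadd A B hAB]
    simp only [← ENNReal.rpow_mul]
    exact hL.add_le (by positivity) (hmem A) (hmem B) (hsupp A B hAB)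

end Quasinorm

/-! ### The upper bound for the constant of convexity -/

/-- A measurable labelling of `[0, 1]` by the levels `exp (-η k)`, `k < m`, with all points below
`exp (-η m)` put at the level `m`. -/
lemma exists_measurable_level {η : ℝ} (hη : 0 < η) (m : ℕ) : ∃ lab : ℝ → Fin (m + 1),
    Measurable lab ∧ (∀ t, (lab t : ℕ) < m → Real.exp (-(η * ((lab t : ℕ) + 1))) ≤ t) ∧
      ∀ t, 0 ≤ t → t ≤ 1 → t ≤ Real.exp (-(η * (lab t : ℕ))) := by
  let g : ℝ → ℕ := fun t => if t ≤ Real.exp (-(η * m)) then m else min m ⌊-Real.log t / η⌋₊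
  have hg : Measurable g := by
    refine Measurable.ite measurableSet_Iic measurable_const ?_
    exact measurable_const.min (Nat.measurable_floor.comp (Real.measurable_log.neg.div_const η))
  have hgm : ∀ t, g t < m + 1 := fun t => by
    simp only [g]
    split_ifs <;> omega
  refine ⟨fun t => ⟨g t, hgm t⟩, ?_, ?_, ?_⟩
  · have e : (fun t => (⟨g t, hgm t⟩ : Fin (m + 1))) = (fun k => Fin.ofNat (m + 1) k) ∘ g := by
      ext t
      simp [Fin.ofNat, Nat.mod_eq_of_lt (hgm t)]
    rw [e]
    exact measurable_from_nat.comp hg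
  · intro t ht
    simp only [g] at ht ⊢
    split_ifs at ht ⊢ with h1
    · exact absurd ht (lt_irrefl _)
    · push Not at h1
      have ht0 : 0 < t := (Real.exp_pos _).trans h1
      have e : min m ⌊-Real.log t / η⌋₊ = ⌊-Real.log t / η⌋₊ := by omega
      rw [e]
      have := Nat.lt_floor_add_one (-Real.log t / η)
      rw [div_lt_iff₀ hη] at this
      rw [← Real.le_log_iff_exp_le ht0]
      linarith
  · intro t ht0 ht1
    simp only [g]
    split_ifs with h1
    · exact h1
    · push Not at h1
      have ht0 : 0 < t := (Real.exp_pos _).trans h1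
      rw [← Real.log_le_iff_le_exp ht0]
      have h2 : 0 ≤ -Real.log t / η := div_nonneg (neg_nonneg.2 (Real.log_nonpos ht0.le ht1)) hη.le
      have h3 := Nat.floor_le h2
      rw [le_div_iff₀ hη] at h3
      have h4 : ((min m ⌊-Real.log t / η⌋₊ : ℕ) : ℝ) ≤ ⌊-Real.log t / η⌋₊ := by
        exact_mod_cast min_le_right _ _
      nlinarith [mul_le_mul_of_nonneg_right h4 hη.le]

section Upper

variable {Ω : Type*} [MeasurableSpace Ω] {N : (Ω → ℝ) → ℝ≥0∞}

/-- The convexity estimate for functions with positive bounds `τ i` on `N (f i) ^ p`. -/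
theorem IsAdmissibleQuasinorm.rpow_sum_rpow_le (h : IsAdmissibleQuasinorm N) {r p θ C : ℝ}
    (hr : 0 < r) (hrp : r < p) (hθ : 0 < θ) (hθ1 : θ < 1) (hU : UpperEstimate N p)
    (hL : LowerEstimate N (p * (1 + θ)))
    (hC : ∀ (σ T : ℝ) (m : ℕ) (x : ℕ → ℝ), 0 ≤ T → (∀ k, 0 ≤ x k) →
      ∑ k ∈ Finset.range m, x k ^ (1 + θ) ≤ T ^ (1 + θ) →
      ∑ k ∈ Finset.range m, x k * convexityWeight (r / p) (Real.exp (-(k * θ + σ)))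
        ≤ (C / θ) ^ θ * T)
    {n : ℕ} {f : Fin n → Ω → ℝ} (hf : ∀ i, MemSpace N (f i)) {τ : Fin n → ℝ}
    (hτ0 : ∀ i, 0 < τ i) (hτ : ∀ i, N (f i) ^ p ≤ ENNReal.ofReal (τ i)) :
    N (fun x => (∑ i, |f i x| ^ r) ^ (1 / r)) ^ p ≤
      ENNReal.ofReal ((1 + 3 * θ) *
        (Real.exp (2 * θ) * (C / θ) ^ θ * (∑ i, τ i ^ (r / p)) ^ (1 / (r / p)))) := by
  have hp : 0 < p := hr.trans hrp
  set R := r / p with hR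
  have hR0 : 0 < R := div_pos hr hp
  have hR1 : R < 1 := (div_lt_one hp).2 hrp
  set F : Ω → ℝ := fun x => (∑ i, |f i x| ^ r) ^ (1 / r) with hFdef
  have hF : MemSpace N F := h.memSpace_rpow_sum hr hf
  have hsum0 : ∀ x, 0 ≤ ∑ i, |f i x| ^ r := fun x =>
    Finset.sum_nonneg fun _ _ => Real.rpow_nonneg (abs_nonneg _) _
  have hF0 : ∀ x, 0 ≤ F x := fun x => Real.rpow_nonneg (hsum0 x) _
  have hFr : ∀ x, F x ^ r = ∑ i, |f i x| ^ r := fun x => by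
    rw [hFdef, ← Real.rpow_mul (hsum0 x), one_div_mul_cancel hr.ne', Real.rpow_one]
  have hfF : ∀ i x, |f i x| ≤ F x := fun i x => by
    rw [← Real.rpow_le_rpow_iff (abs_nonneg _) (hF0 x) hr, hFr]
    exact Finset.single_le_sum (f := fun i => |f i x| ^ r)
      (fun _ _ => Real.rpow_nonneg (abs_nonneg _) _) (Finset.mem_univ i)
  -- enough levels for the functions below the last level to be negligible
  obtain ⟨m, hm⟩ : ∃ m : ℕ, n * Real.exp (-(θ * R * m)) ≤ 1 - Real.exp (-(θ * R)) := by
    have hq : Real.exp (-(θ * R)) < 1 := by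
      rw [Real.exp_lt_one_iff]
      nlinarith [mul_pos hθ hR0]
    have ht : Filter.Tendsto (fun m : ℕ => n * Real.exp (-(θ * R)) ^ m) Filter.atTop
        (nhds (n * 0)) :=
      (tendsto_pow_atTop_nhds_zero_of_lt_one (Real.exp_pos _).le hq).const_mul _
    rw [mul_zero] at ht
    obtain ⟨m, hm⟩ := (ht.eventually (gt_mem_nhds (sub_pos.2 hq))).exists
    refine ⟨m, le_of_eq_of_le ?_ hm.le⟩
    rw [← Real.exp_nat_mul]
    congr 2; ring
  have hη : 0 < θ / p := div_pos hθ hp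
  obtain ⟨lab, hlabm, hlab1, hlab2⟩ := exists_measurable_level hη m
  set l : Ω → Fin n → Fin (m + 1) := fun x i => lab (|f i x| / F x) with hl
  have hlm : Measurable l := measurable_pi_lambda _ fun i =>
    hlabm.comp ((hf i).1.abs.div hF.1)
  have hlow : ∀ i x, (l x i : ℕ) < m →
      Real.exp (-(θ / p * ((l x i : ℕ) + 1))) * F x ≤ |f i x| := fun i x hx => by
    have h1 := hlab1 _ hx
    rcases (hF0 x).eq_or_lt with h0 | h0
    · rw [← h0, mul_zero]; exact abs_nonneg _
    · rwa [le_div_iff₀ h0] at h1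
  have hφ := isLowerSubmeasure_restrict h hp hθ hU hL hlm hF
  set φ : Finset (Fin n → Fin (m + 1)) → ℝ := fun A =>
    (N ((l ⁻¹' (A : Set (Fin n → Fin (m + 1)))).indicator F) ^ p).toReal with hφdef
  have hmain := hφ.univ_le_of_levels hR0 hR1 hθ hθ1 hC τ hτ0 ?_ ?_
  · have e : φ Finset.univ = (N F ^ p).toReal := by simp [hφdef]
    rw [e] at hmain
    rw [← ENNReal.ofReal_toReal (ENNReal.rpow_lt_top_of_nonneg hp.le hF.2.ne).ne]
    exact ENNReal.ofReal_le_ofReal hmain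
  · intro i
    -- the pieces of `f i` at its various levels
    set S : ℕ → Set Ω := fun k => {x | (l x i : ℕ) = k} with hS
    have hSm : ∀ k, MeasurableSet (S k) := fun k =>
      ((measurable_of_finite fun a : Fin (m + 1) => (a : ℕ)).comp
        ((measurable_pi_apply i).comp hlm)) (measurableSet_singleton k)
    have hg : ∀ k, MemSpace N ((S k).indicator (f i)) := fun k =>
      h.memSpace_of_le ((hf i).1.indicator (hSm k)) (hf i) fun x => by
        by_cases hx : x ∈ S k
        · rw [Set.indicator_of_mem hx]
        · rw [Set.indicator_of_notMem hx]; simp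
    have hpre : ∀ k : ℕ, l ⁻¹' ((Finset.univ.filter fun a : Fin n → Fin (m + 1) =>
        (a i : ℕ) = k : Finset _) : Set (Fin n → Fin (m + 1))) = S k := fun k => by
      ext x; simp [hS]
    have h1 : ∀ k < m, ENNReal.ofReal (Real.exp (-(θ * (k + 1)))
        * φ (Finset.univ.filter fun a => (a i : ℕ) = k)) ≤ N ((S k).indicator (f i)) ^ p := by
      intro k hk
      have hFk : MemSpace N ((S k).indicator F) :=
        h.memSpace_of_le (hF.1.indicator (hSm k)) hF fun x => by
          by_cases hx : x ∈ S k
          · rw [Set.indicator_of_mem hx]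
          · rw [Set.indicator_of_notMem hx]; simp
      have h2 : N (fun x => Real.exp (-(θ / p * (k + 1))) * (S k).indicator F x)
          ≤ N ((S k).indicator (f i)) := by
        refine h.mono _ _ (hFk.1.const_mul _) (hg k).1 fun x => ?_
        by_cases hx : x ∈ S k
        · rw [Set.indicator_of_mem hx, Set.indicator_of_mem hx,
            abs_of_nonneg (mul_nonneg (Real.exp_pos _).le (hF0 x))]
          have hx' : (l x i : ℕ) = k := hx
          have := hlow i x (by rw [hx']; exact hk)
          rwa [hx'] at this
        · rw [Set.indicator_of_notMem hx, Set.indicator_of_notMem hx]; simp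
      rw [h.smul _ _ hFk.1] at h2
      refine le_trans (le_of_eq ?_) (ENNReal.rpow_le_rpow h2 hp.le)
      rw [ENNReal.ofReal_mul (Real.exp_pos _).le, ENNReal.mul_rpow_of_nonneg _ _ hp.le]
      congr 1
      · rw [Real.enorm_of_nonneg (Real.exp_pos _).le,
          ENNReal.ofReal_rpow_of_pos (Real.exp_pos _), ← Real.exp_mul]
        congr 2
        field_simp
      · simp only [hφdef]
        rw [ENNReal.ofReal_toReal, hpre]
        rw [hpre]
        exact (ENNReal.rpow_lt_top_of_nonneg hp.le hFk.2.ne).ne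
    have h3 : ∑ k : Fin m, N ((S k).indicator (f i)) ^ (p * (1 + θ)) ≤ N (f i) ^ (p * (1 + θ)) := by
      have hd : Pairwise fun k k' : Fin m => Disjoint (Function.support ((S k).indicator (f i)))
          (Function.support ((S k').indicator (f i))) := by
        intro k k' hkk
        refine Disjoint.mono Set.support_indicator_subset Set.support_indicator_subset ?_
        rw [Set.disjoint_left]
        intro x hx hx'
        exact hkk (Fin.ext ((show (l x i : ℕ) = k from hx).symm.trans hx'))
      refine (hL.sum_le (by positivity) (fun k : Fin m => hg k) hd).trans ?_
      refine ENNReal.rpow_le_rpow (h.mono _ _ (Finset.measurable_sum _ fun k _ => (hg k).1)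
        (hf i).1 fun x => ?_) (by positivity)
      by_cases hx : (l x i : ℕ) < m
      · rw [Finset.sum_eq_single (⟨l x i, hx⟩ : Fin m)]
        · rw [Set.indicator_of_mem]
          rfl
        · intro k _ hk
          rw [Set.indicator_of_notMem]
          intro hxk
          exact hk (Fin.ext (show (l x i : ℕ) = k from hxk).symm)
        · simp
      · rw [Finset.sum_eq_zero]
        · simp
        · intro k _
          rw [Set.indicator_of_notMem]
          intro hxk
          have : (l x i : ℕ) = k := hxk
          have := k.2
          omega
    rw [← ENNReal.ofReal_le_ofReal_iff (Real.rpow_nonneg (hτ0 i).le _),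
      ENNReal.ofReal_sum_of_nonneg (fun k _ => Real.rpow_nonneg
        (mul_nonneg (Real.exp_pos _).le (hφ.nonneg _)) _)]
    calc _ ≤ ∑ k ∈ Finset.range m, (N ((S k).indicator (f i)) ^ p) ^ (1 + θ) := by
          refine Finset.sum_le_sum fun k hk => ?_
          rw [← ENNReal.ofReal_rpow_of_nonneg (mul_nonneg (Real.exp_pos _).le (hφ.nonneg _))
            (by positivity)]
          exact ENNReal.rpow_le_rpow (h1 k (Finset.mem_range.1 hk)) (by positivity)
      _ = ∑ k : Fin m, N ((S k).indicator (f i)) ^ (p * (1 + θ)) := by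
          rw [Finset.sum_range]
          simp only [ENNReal.rpow_mul]
      _ ≤ (N (f i) ^ p) ^ (1 + θ) := by rw [← ENNReal.rpow_mul]; exact h3
      _ ≤ ENNReal.ofReal (τ i) ^ (1 + θ) := ENNReal.rpow_le_rpow (hτ i) (by positivity)
      _ = _ := ENNReal.ofReal_rpow_of_pos (hτ0 i)
  · intro a ha
    obtain ⟨x, hxa, hx⟩ : ∃ x, l x = a ∧ F x ≠ 0 := by
      by_contra! hcon
      apply ha
      have : (l ⁻¹' (({a} : Finset (Fin n → Fin (m + 1))) : Set (Fin n → Fin (m + 1)))).indicator F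
          = fun _ => 0 := by
        ext x
        by_cases hx : l x = a
        · rw [Set.indicator_of_mem (by simpa using hx)]
          exact hcon x hx
        · rw [Set.indicator_of_notMem (by simpa using hx)]
      simp only [hφdef]
      rw [this, h.map_zero, ENNReal.zero_rpow_of_pos hp, ENNReal.toReal_zero]
    have hFx : 0 < F x := lt_of_le_of_ne (hF0 x) (Ne.symm hx)
    have hone : ∑ i, (|f i x| / F x) ^ r = 1 := by
      simp only [Real.div_rpow (abs_nonneg _) hFx.le, ← Finset.sum_div, ← hFr]
      exact div_self (Real.rpow_pos_of_pos hFx _).ne'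
    have hpt : ∀ i, (|f i x| / F x) ^ r ≤ Real.exp (θ * R) *
        (if (a i : ℕ) < m then Real.exp (-(θ * ((a i : ℕ) + 1))) else 0) ^ R
          + Real.exp (-(θ * R * m)) := by
      intro i
      have h1 : (|f i x| / F x) ^ r ≤ Real.exp (-(θ / p * (a i : ℕ))) ^ r := by
        refine Real.rpow_le_rpow (by positivity) ?_ hr.le
        have := hlab2 (|f i x| / F x) (by positivity) ((div_le_one hFx).2 (hfF i x))
        rw [← hxa]
        exact this
      have h2 : Real.exp (-(θ / p * (a i : ℕ))) ^ r = Real.exp (-(θ * R * (a i : ℕ))) := by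
        rw [← Real.exp_mul, hR]
        congr 1
        field_simp
      rw [h2] at h1
      by_cases hi : (a i : ℕ) < m
      · simp only [hi, if_true]
        rw [← Real.exp_mul, ← Real.exp_add]
        have e : θ * R + -(θ * ((a i : ℕ) + 1)) * R = -(θ * R * (a i : ℕ)) := by ring
        rw [e]
        linarith [Real.exp_pos (-(θ * R * m))]
      · have e : (a i : ℕ) = m := by have := (a i).2; omega
        simp only [hi, if_false, Real.zero_rpow hR0.ne', mul_zero, zero_add]
        rwa [e] at h1
    have h3 := Finset.sum_le_sum fun i (_ : i ∈ Finset.univ) => hpt i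
    rw [hone, Finset.sum_add_distrib, ← Finset.mul_sum, Finset.sum_const, Finset.card_univ,
      Fintype.card_fin, nsmul_eq_mul] at h3
    have h4 : Real.exp (-(θ * R)) ≤ Real.exp (θ * R) * ∑ i,
        (if (a i : ℕ) < m then Real.exp (-(θ * ((a i : ℕ) + 1))) else 0) ^ R := by linarith
    calc Real.exp (-(2 * θ * R)) = Real.exp (-(θ * R)) * Real.exp (-(θ * R)) := by
          rw [← Real.exp_add]; congr 1; ring
      _ ≤ Real.exp (-(θ * R)) * (Real.exp (θ * R) * ∑ i,
          (if (a i : ℕ) < m then Real.exp (-(θ * ((a i : ℕ) + 1))) else 0) ^ R) :=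
          mul_le_mul_of_nonneg_left h4 (Real.exp_pos _).le
      _ = _ := by rw [← mul_assoc, ← Real.exp_add]; simp

theorem IsAdmissibleQuasinorm.log_convexityConst_le (h : IsAdmissibleQuasinorm N) {r p θ C : ℝ}
    (hr : 0 < r) (hrp : r < p) (hθ : 0 < θ) (hθ1 : θ < 1) (hU : UpperEstimate N p)
    (hL : LowerEstimate N (p * (1 + θ))) (hC1 : 1 ≤ C)
    (hC : ∀ (σ T : ℝ) (m : ℕ) (x : ℕ → ℝ), 0 ≤ T → (∀ k, 0 ≤ x k) →
      ∑ k ∈ Finset.range m, x k ^ (1 + θ) ≤ T ^ (1 + θ) →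
      ∑ k ∈ Finset.range m, x k * convexityWeight (r / p) (Real.exp (-(k * θ + σ)))
        ≤ (C / θ) ^ θ * T) :
    ENNReal.log (convexityConst N r)
      ≤ ((θ * ((5 + Real.log C) / p + |Real.log θ| / p) : ℝ) : EReal) := by
  have hp : 0 < p := hr.trans hrp
  set E : ℝ := θ * ((5 + Real.log C) / p + |Real.log θ| / p) with hE
  have hconst : (1 + 3 * θ) * (Real.exp (2 * θ) * (C / θ) ^ θ) ≤ Real.exp E ^ p := by
    have h1 : (C / θ) ^ θ = Real.exp (θ * (Real.log C + |Real.log θ|)) := by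
      rw [Real.rpow_def_of_pos (by positivity), Real.log_div (by positivity) hθ.ne',
        abs_of_nonpos (Real.log_nonpos hθ.le hθ1.le)]
      congr 1; ring
    calc _ ≤ Real.exp (3 * θ) * (Real.exp (2 * θ) * (C / θ) ^ θ) := by
          gcongr
          linarith [Real.add_one_le_exp (3 * θ)]
      _ = Real.exp E ^ p := by
          rw [h1, ← Real.exp_add, ← Real.exp_add, ← Real.exp_mul, hE]
          congr 1
          field_simp
          ring
  have hbound : convexityConst N r ≤ ENNReal.ofReal (Real.exp E) := by
    refine sInf_le ?_
    intro n f hf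
    set a : Fin n → ℝ := fun i => (N (f i)).toReal with ha
    have ha0 : ∀ i, 0 ≤ a i := fun i => ENNReal.toReal_nonneg
    have haN : ∀ i, ENNReal.ofReal (a i) = N (f i) := fun i => ENNReal.ofReal_toReal (hf i).2.ne
    have hε : ∀ ε : ℝ, 0 < ε → N (fun x => (∑ i, |f i x| ^ r) ^ (1 / r))
        ≤ ENNReal.ofReal (Real.exp E * (∑ i, (a i + ε) ^ r) ^ (1 / r)) := by
      intro ε hε
      have hpos : ∀ i, 0 < a i + ε := fun i => add_pos_of_nonneg_of_pos (ha0 i) hε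
      have H := h.rpow_sum_rpow_le hr hrp hθ hθ1 hU hL hC hf (τ := fun i => (a i + ε) ^ p)
        (fun i => Real.rpow_pos_of_pos (hpos i) _) (fun i => by
          rw [← ENNReal.ofReal_rpow_of_pos (hpos i), ← haN i]
          exact ENNReal.rpow_le_rpow (ENNReal.ofReal_le_ofReal (by linarith)) hp.le)
      have hS0 : 0 ≤ ∑ i, (a i + ε) ^ r :=
        Finset.sum_nonneg fun i _ => Real.rpow_nonneg (hpos i).le _
      have e1 : (∑ i, ((a i + ε) ^ p) ^ (r / p)) ^ (1 / (r / p))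
          = ((∑ i, (a i + ε) ^ r) ^ (1 / r)) ^ p := by
        have e2 : ∀ i, ((a i + ε) ^ p) ^ (r / p) = (a i + ε) ^ r := fun i => by
          rw [← Real.rpow_mul (hpos i).le]
          congr 1
          field_simp
        simp only [e2]
        rw [← Real.rpow_mul hS0]
        congr 1
        field_simp
      rw [e1] at H
      have hT0 : 0 ≤ (∑ i, (a i + ε) ^ r) ^ (1 / r) := Real.rpow_nonneg hS0 _
      rw [← ENNReal.rpow_le_rpow_iff hp, ENNReal.ofReal_rpow_of_nonneg (by positivity) hp.le,
        Real.mul_rpow (Real.exp_pos _).le hT0]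
      refine H.trans (ENNReal.ofReal_le_ofReal ?_)
      rw [← mul_assoc]
      exact mul_le_mul_of_nonneg_right hconst (by positivity)
    have hcont : Continuous fun ε : ℝ =>
        ENNReal.ofReal (Real.exp E * (∑ i, (a i + ε) ^ r) ^ (1 / r)) := by
      refine ENNReal.continuous_ofReal.comp (continuous_const.mul ?_)
      refine Continuous.rpow_const ?_ fun _ => Or.inr (by positivity)
      exact continuous_finsetSum _ fun i _ =>
        (continuous_const.add continuous_id).rpow_const fun _ => Or.inr hr.le
    have hlim := ge_of_tendsto (hcont.continuousWithinAt (s := Set.Ioi 0) (x := 0))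
      (Filter.eventually_of_mem self_mem_nhdsWithin hε)
    refine hlim.trans (le_of_eq ?_)
    simp only [add_zero]
    rw [ENNReal.ofReal_mul (Real.exp_pos _).le,
      ← ENNReal.ofReal_rpow_of_nonneg (Finset.sum_nonneg fun i _ => Real.rpow_nonneg (ha0 i) _)
        (by positivity), ENNReal.ofReal_sum_of_nonneg fun i _ => Real.rpow_nonneg (ha0 i) _]
    simp only [← ENNReal.ofReal_rpow_of_nonneg (ha0 _) hr.le, haN]
  calc ENNReal.log (convexityConst N r) ≤ ENNReal.log (ENNReal.ofReal (Real.exp E)) :=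
        ENNReal.log_monotone hbound
    _ = (E : EReal) := by
        rw [ENNReal.log_ofReal_of_pos (Real.exp_pos _), Real.log_exp]

end Upper

/-- The upper bound for the constant of `r`-convexity. For `θ = 0` it is obtained by letting
`θ → 0`, since a lower `p`-estimate implies all lower `p (1 + θ)`-estimates. -/
theorem exists_log_convexityConst_le {r p : ℝ} (hr : 0 < r) (hrp : r < p) : ∃ c : ℝ,
    ∀ (Ω : Type*) [MeasurableSpace Ω] (N : (Ω → ℝ) → ℝ≥0∞), IsAdmissibleQuasinorm N →
      ∀ θ : ℝ, 0 ≤ θ → θ < 1 → UpperEstimate N p → LowerEstimate N (p * (1 + θ)) →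
        ENNReal.log (convexityConst N r) ≤ ((θ * (c + |Real.log θ| / p) : ℝ) : EReal) := by
  have hp : 0 < p := hr.trans hrp
  obtain ⟨C, hC1, hC⟩ := exists_sum_mul_convexityWeight_le (div_pos hr hp) ((div_lt_one hp).2 hrp)
  refine ⟨(5 + Real.log C) / p, ?_⟩
  intro Ω _ N h θ hθ hθ1 hU hL
  rcases hθ.eq_or_lt with rfl | hθ
  · have hcont : Continuous fun t : ℝ => t * ((5 + Real.log C) / p) + |t * Real.log t| / p := by
      have := Real.continuous_mul_log
      fun_prop
    have hlim : Filter.Tendsto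
        (fun t : ℝ => ((t * ((5 + Real.log C) / p) + |t * Real.log t| / p : ℝ) : EReal))
        (nhdsWithin 0 (Set.Ioi 0)) (nhds ((0 : ℝ) : EReal)) := by
      have := ((continuous_coe_real_ereal.comp hcont).continuousWithinAt (s := Set.Ioi 0)
        (x := 0)).tendsto
      rw [show ((0 : ℝ) : EReal) = (((0 : ℝ) * ((5 + Real.log C) / p)
        + |(0 : ℝ) * Real.log 0| / p : ℝ) : EReal) by norm_num]
      exact this
    rw [zero_mul]
    refine ge_of_tendsto hlim ?_
    filter_upwards [Ioo_mem_nhdsGT (zero_lt_one' ℝ)] with t ht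
    have := h.log_convexityConst_le hr hrp ht.1 ht.2 hU
      (hL.mono (by linarith) (by nlinarith [ht.1])) hC1 (hC t · · · · ht.1 ht.2)
    refine this.trans (le_of_eq ?_)
    rw [abs_mul, abs_of_pos ht.1]
    congr 1
    ring
  · exact h.log_convexityConst_le hr hrp hθ hθ1 hU hL hC1 (hC θ · · · · hθ hθ1)

/-! ### The spaces `Λ_{p,q}` -/

/-- Two functions with disjoint supports: one of them agrees with the sum on its support. -/
lemma add_eq_of_mem_support {Ω : Type*} {f g : Ω → ℝ}
    (hd : Disjoint (Function.support f) (Function.support g)) {x : Ω}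
    (hx : x ∈ Function.support f) : f x + g x = f x := by
  have : x ∉ Function.support g := Set.disjoint_left.1 hd hx
  rw [Function.notMem_support.1 this, add_zero]

lemma disjoint_support_sum {Ω : Type*} {n : ℕ} {f₀ : Ω → ℝ} {f : Fin n → Ω → ℝ}
    (hd : ∀ i, Disjoint (Function.support f₀) (Function.support (f i))) :
    Disjoint (Function.support f₀) (Function.support fun x => ∑ i, f i x) := by
  rw [Set.disjoint_left]
  intro x hx hx'
  refine hx' (Finset.sum_eq_zero fun i _ => ?_)
  exact Function.notMem_support.1 (Set.disjoint_left.1 (hd i) hx)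

section Lambda

open MeasureTheory

variable {Ω : Type*} [MeasurableSpace Ω] {μ : Measure Ω} {p q : ℝ}

/-- The contribution of a cell `A` of a partition to the `q`-th power of the quasinorm of
`Λ_{p,q}(μ)`. -/
noncomputable def lambdaCell (μ : Measure Ω) (p q : ℝ) (f : Ω → ℝ) (A : Set Ω) : ℝ≥0∞ :=
  (⨅ x ∈ A, ‖f x‖ₑ) ^ q * μ A ^ (q / p)

/-- A finite measurable partition. -/
structure MeasurablePartition (Ω : Type*) [MeasurableSpace Ω] where
  /-- the number of cells -/
  n : ℕ
  /-- the cells -/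
  cell : Fin n → Set Ω
  measurableSet_cell : ∀ i, MeasurableSet (cell i)
  disjoint : Pairwise fun i j => Disjoint (cell i) (cell j)
  iUnion_eq : ⋃ i, cell i = Set.univ

/-- The partition with one cell. -/
instance : Inhabited (MeasurablePartition Ω) :=
  ⟨⟨1, fun _ => Set.univ, fun _ => .univ, fun i j h => absurd (Subsingleton.elim i j) h,
    Set.iUnion_const Set.univ⟩⟩

lemma lambdaNorm_rpow (hq : 0 < q) (f : Ω → ℝ) : lambdaNorm μ p q f ^ q
    = ⨆ P : MeasurablePartition Ω, ∑ i, lambdaCell μ p q f (P.cell i) := by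
  apply le_antisymm
  · rw [← ENNReal.le_rpow_inv_iff hq, ← one_div]
    refine iSup_le fun n => iSup_le fun A => iSup_le fun h1 => iSup_le fun h2 => iSup_le fun h3 => ?_
    exact ENNReal.rpow_le_rpow (le_iSup (fun P : MeasurablePartition Ω =>
      ∑ i, lambdaCell μ p q f (P.cell i)) ⟨n, A, h1, h2, h3⟩) (by positivity)
  · refine iSup_le fun P => ?_
    rw [← ENNReal.rpow_inv_le_iff hq, ← one_div]
    exact le_iSup_of_le P.n <| le_iSup_of_le P.cell <| le_iSup_of_le P.measurableSet_cell <|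
      le_iSup_of_le P.disjoint <| le_iSup_of_le P.iUnion_eq le_rfl

/-- A disjoint family need not cover the space to give a lower bound for the quasinorm. -/
lemma sum_lambdaCell_le (hq : 0 < q) (f : Ω → ℝ) {ι : Type*} [Fintype ι] {A : ι → Set Ω}
    (hA : ∀ i, MeasurableSet (A i)) (hd : Pairwise fun i j => Disjoint (A i) (A j)) :
    ∑ i, lambdaCell μ p q f (A i) ≤ lambdaNorm μ p q f ^ q := by
  classical
  let B : Option ι → Set Ω := fun o => o.elim (⋃ i, A i)ᶜ A
  have hB : ∀ o, MeasurableSet (B o) := by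
    rintro (_ | i)
    · exact (MeasurableSet.iUnion hA).compl
    · exact hA i
  have hBd : Pairwise fun o o' => Disjoint (B o) (B o') := by
    rintro (_ | i) (_ | j) hij
    · exact absurd rfl hij
    · exact disjoint_compl_left.mono_right (Set.subset_iUnion A j)
    · exact disjoint_compl_right.mono_left (Set.subset_iUnion A i)
    · exact hd fun h => hij (congrArg some h)
  have hBu : ⋃ o, B o = Set.univ := by
    rw [Set.iUnion_option]
    exact Set.compl_union_self _
  let e := Fintype.equivFin (Option ι)
  let P : MeasurablePartition Ω := ⟨_, fun k => B (e.symm k), fun k => hB _,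
    fun k k' h => hBd fun h' => h (e.symm.injective h'),
    by rw [← hBu]; exact e.symm.surjective.iUnion_comp B⟩
  rw [lambdaNorm_rpow hq]
  refine le_trans ?_ (le_iSup (fun P : MeasurablePartition Ω =>
    ∑ i, lambdaCell μ p q f (P.cell i)) P)
  have : ∑ i, lambdaCell μ p q f (P.cell i) = ∑ o, lambdaCell μ p q f (B o) :=
    e.symm.sum_comp fun o => lambdaCell μ p q f (B o)
  rw [this, Fintype.sum_option]
  exact le_add_self

lemma lambdaCell_eq_zero_of_mem (hq : 0 < q) {f : Ω → ℝ} {A : Set Ω} {x : Ω} (hx : x ∈ A)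
    (hfx : f x = 0) : lambdaCell μ p q f A = 0 := by
  have : (⨅ x ∈ A, ‖f x‖ₑ) = 0 := by
    refine le_antisymm ((iInf₂_le x hx).trans (by simp [hfx])) zero_le
  rw [lambdaCell, this, ENNReal.zero_rpow_of_pos hq, zero_mul]

lemma lambdaCell_empty (hp : 0 < p) (hq : 0 < q) (f : Ω → ℝ) : lambdaCell μ p q f ∅ = 0 := by
  rw [lambdaCell, measure_empty, ENNReal.zero_rpow_of_pos (by positivity), mul_zero]

lemma lambdaCell_mono (hq : 0 < q) {f g : Ω → ℝ} {A : Set Ω} (hfg : ∀ x ∈ A, ‖f x‖ₑ ≤ ‖g x‖ₑ) :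
    lambdaCell μ p q f A ≤ lambdaCell μ p q g A :=
  mul_le_mul_left (ENNReal.rpow_le_rpow (iInf₂_mono hfg) hq.le) _

lemma lambdaNorm_mono (hq : 0 < q) {f g : Ω → ℝ} (hfg : ∀ x, |f x| ≤ |g x|) :
    lambdaNorm μ p q f ≤ lambdaNorm μ p q g := by
  rw [← ENNReal.rpow_le_rpow_iff hq, lambdaNorm_rpow hq, lambdaNorm_rpow hq]
  refine iSup_mono fun P => Finset.sum_le_sum fun i _ => lambdaCell_mono hq fun x _ => ?_
  rw [enorm_le_iff_norm_le]
  exact hfg x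

lemma lambdaNorm_zero (hp : 0 < p) (hq : 0 < q) : lambdaNorm μ p q (fun _ => 0) = 0 := by
  have : lambdaNorm μ p q (fun _ => 0) ^ q = 0 := by
    rw [lambdaNorm_rpow hq, ENNReal.iSup_eq_zero]
    refine fun P => Finset.sum_eq_zero fun i _ => ?_
    rcases (P.cell i).eq_empty_or_nonempty with h | ⟨x, hx⟩
    · rw [h, lambdaCell_empty hp hq]
    · exact lambdaCell_eq_zero_of_mem hq hx rfl
  rwa [ENNReal.rpow_eq_zero_iff_of_pos hq] at this

lemma lambdaNorm_smul (hp : 0 < p) (hq : 0 < q) (c : ℝ) (f : Ω → ℝ) :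
    lambdaNorm μ p q (fun x => c * f x) = ‖c‖ₑ * lambdaNorm μ p q f := by
  rcases eq_or_ne c 0 with rfl | hc
  · simp [lambdaNorm_zero hp hq]
  apply ENNReal.rpow_left_injective hq.ne'
  simp only
  rw [ENNReal.mul_rpow_of_nonneg _ _ hq.le, lambdaNorm_rpow hq, lambdaNorm_rpow hq,
    ENNReal.mul_iSup]
  refine iSup_congr fun P => ?_
  rw [Finset.mul_sum]
  refine Finset.sum_congr rfl fun i _ => ?_
  rw [lambdaCell, lambdaCell, ← mul_assoc, ← ENNReal.mul_rpow_of_nonneg _ _ hq.le]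
  congr 2
  have hc0 : ‖c‖ₑ ≠ 0 := by simpa using hc
  simp only [enorm_mul]
  rw [ENNReal.mul_iInf_of_ne hc0 enorm_ne_top]
  simp only [ENNReal.mul_iInf_of_ne hc0 enorm_ne_top]

lemma lambdaCell_le_inter_support (hq : 0 < q) {f g : Ω → ℝ}
    (hd : Disjoint (Function.support f) (Function.support g)) (A : Set Ω) :
    lambdaCell μ p q f A ≤ lambdaCell μ p q (fun x => f x + g x) (A ∩ Function.support f) := by
  by_cases hA : A ⊆ Function.support f
  · rw [Set.inter_eq_left.2 hA]
    refine lambdaCell_mono hq fun x hx => ?_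
    rw [add_eq_of_mem_support hd (hA hx)]
  · obtain ⟨x, hxA, hx⟩ := Set.not_subset.1 hA
    rw [lambdaCell_eq_zero_of_mem hq hxA (Function.notMem_support.1 hx)]
    exact zero_le

lemma lambdaNorm_lower_add (hq : 0 < q) {f g : Ω → ℝ} (hf : Measurable f) (hg : Measurable g)
    (hd : Disjoint (Function.support f) (Function.support g)) :
    lambdaNorm μ p q f ^ q + lambdaNorm μ p q g ^ q
      ≤ lambdaNorm μ p q (fun x => f x + g x) ^ q := by
  rw [lambdaNorm_rpow hq f, lambdaNorm_rpow hq g]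
  refine ENNReal.iSup_add_iSup_le fun P Q => ?_
  let B : Fin P.n ⊕ Fin Q.n → Set Ω := Sum.elim (fun i => P.cell i ∩ Function.support f)
    fun j => Q.cell j ∩ Function.support g
  have hB : ∀ k, MeasurableSet (B k) := by
    rintro (i | j)
    · exact (P.measurableSet_cell i).inter (measurableSet_support hf)
    · exact (Q.measurableSet_cell j).inter (measurableSet_support hg)
  have hBd : Pairwise fun k k' => Disjoint (B k) (B k') := by
    rintro (i | i) (j | j) hij
    · exact (P.disjoint fun h => hij (congrArg _ h)).mono Set.inter_subset_left
        Set.inter_subset_left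
    · exact hd.mono Set.inter_subset_right Set.inter_subset_right
    · exact hd.symm.mono Set.inter_subset_right Set.inter_subset_right
    · exact (Q.disjoint fun h => hij (congrArg _ h)).mono Set.inter_subset_left
        Set.inter_subset_left
  refine le_trans ?_ (sum_lambdaCell_le hq _ hB hBd)
  rw [Fintype.sum_sum_type]
  refine add_le_add (Finset.sum_le_sum fun i _ => lambdaCell_le_inter_support hq hd _)
    (Finset.sum_le_sum fun j _ => ?_)
  have := lambdaCell_le_inter_support (μ := μ) (p := p) hq hd.symm (Q.cell j)
  simp only [add_comm (g _)] at this
  exact this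

lemma sum_rpow_mul_inter_le (hp : 0 < p) (hq : 0 < q) {f g : Ω → ℝ} (hf : Measurable f)
    (hd : Disjoint (Function.support f) (Function.support g)) (P : MeasurablePartition Ω) :
    ∑ i, ((⨅ x ∈ P.cell i, ‖f x + g x‖ₑ) ^ p * μ (P.cell i ∩ Function.support f)) ^ (q / p)
      ≤ lambdaNorm μ p q f ^ q := by
  refine le_trans (Finset.sum_le_sum fun i _ => ?_) (sum_lambdaCell_le hq f
    (A := fun i => P.cell i ∩ Function.support f)
    (fun i => (P.measurableSet_cell i).inter (measurableSet_support hf))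
    fun i j hij => (P.disjoint hij).mono Set.inter_subset_left Set.inter_subset_left)
  rw [ENNReal.mul_rpow_of_nonneg _ _ (by positivity), ← ENNReal.rpow_mul, mul_div_cancel₀ _ hp.ne',
    lambdaCell]
  refine mul_le_mul_left (ENNReal.rpow_le_rpow (le_iInf₂ fun x hx =>
    (iInf₂_le x hx.1).trans ?_) hq.le) _
  rw [add_eq_of_mem_support hd hx.2]

/-- The upper `p`-estimate for two functions: Minkowski's inequality in `ℓ_{q/p}`. -/
lemma lambdaNorm_upper_add (hp : 0 < p) (hpq : p ≤ q) {f g : Ω → ℝ} (hf : Measurable f)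
    (hg : Measurable g) (hd : Disjoint (Function.support f) (Function.support g)) :
    lambdaNorm μ p q (fun x => f x + g x) ^ p ≤ lambdaNorm μ p q f ^ p + lambdaNorm μ p q g ^ p := by
  have hq : 0 < q := hp.trans_le hpq
  have hs : 1 ≤ q / p := by rwa [one_le_div hp]
  have key : lambdaNorm μ p q (fun x => f x + g x) ^ q
      ≤ (lambdaNorm μ p q f ^ p + lambdaNorm μ p q g ^ p) ^ (q / p) := by
    rw [lambdaNorm_rpow hq]
    refine iSup_le fun P => ?_
    set v : Fin P.n → ℝ≥0∞ := fun i => ⨅ x ∈ P.cell i, ‖f x + g x‖ₑ with hv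
    have hcell : ∀ i, lambdaCell μ p q (fun x => f x + g x) (P.cell i)
        ≤ (v i ^ p * μ (P.cell i ∩ Function.support f)
          + v i ^ p * μ (P.cell i ∩ Function.support g)) ^ (q / p) := by
      intro i
      by_cases hi : P.cell i ⊆ Function.support f ∪ Function.support g
      · rw [← mul_add, ENNReal.mul_rpow_of_nonneg _ _ (by positivity), ← ENNReal.rpow_mul,
          mul_div_cancel₀ _ hp.ne', lambdaCell]
        gcongr
        refine le_trans (measure_mono ?_) (measure_union_le _ _)
        rw [← Set.inter_union_distrib_left]
        exact Set.subset_inter le_rfl hi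
      · obtain ⟨x, hxA, hx⟩ := Set.not_subset.1 hi
        rw [lambdaCell_eq_zero_of_mem hq hxA]
        · exact zero_le
        · simp only [Set.mem_union, not_or, Function.notMem_support] at hx
          rw [hx.1, hx.2, add_zero]
    have hf' := sum_rpow_mul_inter_le (μ := μ) hp hq hf hd P
    have hg' := sum_rpow_mul_inter_le (μ := μ) hp hq hg hd.symm P
    simp only [add_comm (g _)] at hg'
    have hM := ENNReal.Lp_add_le Finset.univ
      (fun i => v i ^ p * μ (P.cell i ∩ Function.support f))
      (fun i => v i ^ p * μ (P.cell i ∩ Function.support g)) hs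
    have hroot : ∀ a b : ℝ≥0∞, a ≤ b ^ q → a ^ (1 / (q / p)) ≤ b ^ p := by
      intro a b hab
      refine (ENNReal.rpow_le_rpow hab (by positivity)).trans (le_of_eq ?_)
      rw [← ENNReal.rpow_mul]
      congr 1
      field_simp
    calc _ ≤ ∑ i, (v i ^ p * μ (P.cell i ∩ Function.support f)
          + v i ^ p * μ (P.cell i ∩ Function.support g)) ^ (q / p) :=
          Finset.sum_le_sum fun i _ => hcell i
      _ = ((∑ i, (v i ^ p * μ (P.cell i ∩ Function.support f)
          + v i ^ p * μ (P.cell i ∩ Function.support g)) ^ (q / p)) ^ (1 / (q / p))) ^ (q / p) := by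
          rw [← ENNReal.rpow_mul, one_div_mul_cancel (by positivity), ENNReal.rpow_one]
      _ ≤ _ := ENNReal.rpow_le_rpow
          (hM.trans (add_le_add (hroot _ _ hf') (hroot _ _ hg'))) (by positivity)
  have := ENNReal.rpow_le_rpow key (z := p / q) (by positivity)
  rw [← ENNReal.rpow_mul, ← ENNReal.rpow_mul] at this
  have e1 : q * (p / q) = p := by field_simp
  have e2 : q / p * (p / q) = 1 := by field_simp
  rwa [e1, e2, ENNReal.rpow_one] at this

lemma lambdaNorm_upperEstimate (hp : 0 < p) (hpq : p ≤ q) : UpperEstimate (lambdaNorm μ p q) p := by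
  intro n f hf hd
  rw [one_div, ENNReal.le_rpow_inv_iff hp]
  induction n with
  | zero => simp [lambdaNorm_zero hp (hp.trans_le hpq), hp]
  | succ n ih =>
    simp only [Fin.sum_univ_succ]
    refine (lambdaNorm_upper_add hp hpq (hf 0).1
      (Finset.measurable_sum _ fun i _ => (hf i.succ).1)
      (disjoint_support_sum fun i => hd (Fin.succ_ne_zero i).symm)).trans ?_
    gcongr
    exact ih _ (fun i => hf i.succ) fun i j hij => hd fun h => hij (Fin.succ_injective _ h)

lemma lambdaNorm_lowerEstimate (hq : 0 < q) : LowerEstimate (lambdaNorm μ p q) q := by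
  intro n f hf hd
  rw [one_div, ENNReal.rpow_inv_le_iff hq]
  induction n with
  | zero => simp
  | succ n ih =>
    simp only [Fin.sum_univ_succ]
    refine le_trans ?_ (lambdaNorm_lower_add hq (hf 0).1
      (Finset.measurable_sum _ fun i _ => (hf i.succ).1)
      (disjoint_support_sum fun i => hd (Fin.succ_ne_zero i).symm))
    gcongr
    exact ih _ (fun i => hf i.succ) fun i j hij => hd fun h => hij (Fin.succ_injective _ h)

lemma enorm_le_lambdaNorm_const [IsProbabilityMeasure μ] (hq : 0 < q) (c : ℝ) :
    ‖c‖ₑ ≤ lambdaNorm μ p q fun _ => c := by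
  rw [← ENNReal.rpow_le_rpow_iff hq]
  refine le_trans ?_ (sum_lambdaCell_le (μ := μ) (p := p) hq (fun _ => c) (ι := Unit)
    (A := fun _ => Set.univ) (fun _ => .univ) fun i j h => absurd (Subsingleton.elim i j) h)
  have : Nonempty Ω := μ.nonempty_of_neZero
  simp [lambdaCell]

lemma lambdaNorm_const_le [IsProbabilityMeasure μ] (hp : 0 < p) (hpq : p ≤ q) (c : ℝ) :
    lambdaNorm μ p q (fun _ => c) ≤ ‖c‖ₑ := by
  have hq : 0 < q := hp.trans_le hpq
  rw [← ENNReal.rpow_le_rpow_iff hq, lambdaNorm_rpow hq]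
  refine iSup_le fun P => ?_
  have hcell : ∀ i, lambdaCell μ p q (fun _ => c) (P.cell i) ≤ ‖c‖ₑ ^ q * μ (P.cell i) := by
    intro i
    rcases (P.cell i).eq_empty_or_nonempty with h | ⟨x, hx⟩
    · rw [h, lambdaCell_empty hp hq]; exact zero_le
    · rw [lambdaCell]
      refine mul_le_mul' (ENNReal.rpow_le_rpow (iInf₂_le x hx) hq.le) ?_
      exact ENNReal.rpow_le_self_of_le_one prob_le_one (by rwa [one_le_div hp])
  calc _ ≤ ∑ i, ‖c‖ₑ ^ q * μ (P.cell i) := Finset.sum_le_sum fun i _ => hcell i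
    _ = ‖c‖ₑ ^ q * μ (⋃ i, P.cell i) := by
        rw [← Finset.mul_sum, measure_iUnion P.disjoint P.measurableSet_cell, tsum_fintype]
    _ = _ := by rw [P.iUnion_eq, measure_univ, mul_one]

/-- The Fatou property: on each cell the functions `F n` eventually exceed any fixed proportion of
the infimum of the limit, outside of a set of small measure. -/
lemma lambdaNorm_fatou [IsFiniteMeasure μ] (hp : 0 < p) (hq : 0 < q) {F : ℕ → Ω → ℝ} {f : Ω → ℝ}
    (hF : ∀ n, Measurable (F n)) (hF0 : ∀ n x, 0 ≤ F n x) (hmono : ∀ x, Monotone fun n => F n x)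
    (hlim : ∀ x, Filter.Tendsto (fun n => F n x) Filter.atTop (nhds (f x))) :
    Filter.Tendsto (fun n => lambdaNorm μ p q (F n)) Filter.atTop (nhds (lambdaNorm μ p q f)) := by
  have hle : ∀ n x, F n x ≤ f x := fun n x => (hmono x).ge_of_tendsto (hlim x) n
  have hf0 : ∀ x, 0 ≤ f x := fun x => (hF0 0 x).trans (hle 0 x)
  have hNmono : Monotone fun n => lambdaNorm μ p q (F n) := fun m n hmn =>
    lambdaNorm_mono hq fun x => by
      rw [abs_of_nonneg (hF0 _ x), abs_of_nonneg (hF0 _ x)]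
      exact hmono x hmn
  suffices h : lambdaNorm μ p q f = ⨆ n, lambdaNorm μ p q (F n) by
    rw [h]; exact tendsto_atTop_iSup hNmono
  refine le_antisymm ?_ (iSup_le fun n => lambdaNorm_mono hq fun x => by
    rw [abs_of_nonneg (hF0 _ x), abs_of_nonneg (hf0 x)]
    exact hle n x)
  set L := ⨆ n, lambdaNorm μ p q (F n) with hL
  rw [← ENNReal.rpow_le_rpow_iff hq, lambdaNorm_rpow hq]
  refine iSup_le fun P => ?_
  -- the infimum on a cell as a real number, with a harmless value on empty cells
  set v : Fin P.n → ℝ := fun i => (⨅ x ∈ P.cell i, ‖f x‖ₑ).toReal with hv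
  have hv0 : ∀ i, 0 ≤ v i := fun i => ENNReal.toReal_nonneg
  have hvle : ∀ i, ∀ x ∈ P.cell i, v i ≤ f x := fun i x hx => by
    have h1 : (⨅ x ∈ P.cell i, ‖f x‖ₑ) ≤ ‖f x‖ₑ := iInf₂_le x hx
    have h2 := ENNReal.toReal_mono enorm_ne_top h1
    rwa [toReal_enorm, Real.norm_of_nonneg (hf0 x)] at h2
  have hcell : ∀ i, lambdaCell μ p q f (P.cell i)
      ≤ ENNReal.ofReal (v i) ^ q * μ (P.cell i) ^ (q / p) := fun i => by
    rcases (P.cell i).eq_empty_or_nonempty with h | ⟨x, hx⟩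
    · rw [h, lambdaCell_empty hp hq]; exact zero_le
    · rw [lambdaCell, hv]
      simp only
      rw [ENNReal.ofReal_toReal]
      exact ne_top_of_le_ne_top enorm_ne_top (iInf₂_le x hx)
  refine (Finset.sum_le_sum fun i _ => hcell i).trans ?_
  have hstep : ∀ t : ℝ, 0 < t → t < 1 →
      ∑ i, ENNReal.ofReal (t * v i) ^ q * μ (P.cell i) ^ (q / p) ≤ L ^ q := by
    intro t ht0 ht1
    let B : ℕ → Fin P.n → Set Ω := fun n i => P.cell i ∩ {x | t * v i ≤ F n x}
    have hBm : ∀ n i, MeasurableSet (B n i) := fun n i =>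
      (P.measurableSet_cell i).inter (measurableSet_le measurable_const (hF n))
    have hBmono : ∀ i, Monotone fun n => B n i := fun i m n hmn x hx =>
      ⟨hx.1, le_trans (show t * v i ≤ F m x from hx.2) (hmono x hmn)⟩
    have hBU : ∀ i, ⋃ n, B n i = P.cell i := fun i => by
      refine Set.Subset.antisymm (Set.iUnion_subset fun n => Set.inter_subset_left) fun x hx => ?_
      rcases (hv0 i).eq_or_lt with h0 | h0
      · refine Set.mem_iUnion.2 ⟨0, hx, ?_⟩
        change t * v i ≤ F 0 x
        rw [← h0, mul_zero]
        exact hF0 0 x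
      · have h1 : t * v i < f x := lt_of_lt_of_le (by nlinarith) (hvle i x hx)
        obtain ⟨n, hn⟩ := ((hlim x).eventually (lt_mem_nhds h1)).exists
        exact Set.mem_iUnion.2 ⟨n, hx, hn.le⟩
    have hBlim : ∀ i, Filter.Tendsto (fun n => ENNReal.ofReal (t * v i) ^ q * μ (B n i) ^ (q / p))
        Filter.atTop (nhds (ENNReal.ofReal (t * v i) ^ q * μ (P.cell i) ^ (q / p))) := fun i => by
      refine ENNReal.Tendsto.const_mul ?_ (Or.inr
        (ENNReal.rpow_lt_top_of_nonneg hq.le ENNReal.ofReal_ne_top).ne)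
      have := tendsto_measure_iUnion_atTop (μ := μ) (hBmono i)
      rw [hBU i] at this
      exact (ENNReal.continuous_rpow_const.tendsto _).comp this
    refine le_of_tendsto' (tendsto_finsetSum _ fun i _ => hBlim i) fun n => ?_
    have h1 : ∑ i, lambdaCell μ p q (F n) (B n i) ≤ lambdaNorm μ p q (F n) ^ q :=
      sum_lambdaCell_le hq _ (hBm n) fun i j hij =>
        (P.disjoint hij).mono Set.inter_subset_left Set.inter_subset_left
    refine le_trans (Finset.sum_le_sum fun i _ => ?_)
      (h1.trans (ENNReal.rpow_le_rpow (le_iSup (fun n => lambdaNorm μ p q (F n)) n) hq.le))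
    rw [lambdaCell]
    gcongr
    refine le_iInf₂ fun x hx => ?_
    rw [Real.enorm_of_nonneg (hF0 n x)]
    exact ENNReal.ofReal_le_ofReal hx.2
  have hcont : Continuous fun t : ℝ =>
      ∑ i, ENNReal.ofReal (t * v i) ^ q * μ (P.cell i) ^ (q / p) := by
    refine continuous_finsetSum _ fun i _ => ?_
    refine (ENNReal.continuous_mul_const ?_).comp (ENNReal.continuous_rpow_const.comp
      (ENNReal.continuous_ofReal.comp (continuous_id.mul continuous_const)))
    exact (ENNReal.rpow_lt_top_of_nonneg (by positivity) (measure_ne_top μ _)).ne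
  have := le_of_tendsto (hcont.continuousWithinAt (s := Set.Iio 1) (x := 1)).tendsto
    (b := L ^ q) (by
      filter_upwards [Ioo_mem_nhdsLT (zero_lt_one' ℝ)] with t ht
      exact hstep t ht.1 ht.2)
  simpa using this

theorem isAdmissibleQuasinorm_lambdaNorm [IsProbabilityMeasure μ] (hp : 0 < p) (hpq : p ≤ q) :
    IsAdmissibleQuasinorm (lambdaNorm μ p q) where
  mono f g _ _ hfg := lambdaNorm_mono (hp.trans_le hpq) hfg
  smul c f _ := lambdaNorm_smul hp (hp.trans_le hpq) c f
  quasi_add := by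
    refine ⟨2 ^ (1 / p), fun f g hf hg _ _ hd => ?_⟩
    rw [← ENNReal.rpow_le_rpow_iff hp]
    refine (lambdaNorm_upper_add hp hpq hf hg hd).trans ?_
    rw [ENNReal.mul_rpow_of_nonneg _ _ hp.le, ENNReal.ofReal_rpow_of_nonneg (by positivity) hp.le,
      ← Real.rpow_mul (by norm_num), one_div_mul_cancel hp.ne', Real.rpow_one,
      ENNReal.ofReal_ofNat, two_mul]
    gcongr
    · exact le_self_add
    · exact le_add_self
  exists_pos := by
    refine ⟨fun _ => 1, measurable_const, fun _ => one_pos, ?_, ?_⟩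
    · exact lt_of_lt_of_le (by simp) (enorm_le_lambdaNorm_const (hp.trans_le hpq) 1)
    · exact (lambdaNorm_const_le hp hpq 1).trans_lt (by simp)
  fatou F f hF _ hF0 hmono hlim := lambdaNorm_fatou hp (hp.trans_le hpq) hF hF0 hmono hlim

end Lambda

/-! ### Sharpness on the unit interval -/

open MeasureTheory in
/-- A measurable labelling of `[0, 1]` by `n` labels, each used on measure at most `1 / n`. -/
lemma exists_measurable_equidistributed (n : ℕ) [NeZero n] : ∃ L : unitInterval → Fin n,
    Measurable L ∧ ∀ j, volume (L ⁻¹' {j}) ≤ (n : ℝ≥0∞)⁻¹ := by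
  have hn : (0 : ℝ) < n := by exact_mod_cast NeZero.pos n
  refine ⟨fun t => Fin.ofNat n ⌊(n : ℝ) * t⌋₊, ?_, fun j => ?_⟩
  · exact (measurable_from_nat (f := fun k => Fin.ofNat n k)).comp
      (Nat.measurable_floor.comp (measurable_subtype_coe.const_mul (n : ℝ)))
  · have hsub : (Subtype.val '' ((fun t : unitInterval => Fin.ofNat n ⌊(n : ℝ) * t⌋₊) ⁻¹' {j}))
        ⊆ Set.Ico ((j : ℝ) / n) ((j + 1 : ℝ) / n) ∪ {1} := by
      rintro _ ⟨t, ht, rfl⟩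
      rcases t.2.2.eq_or_lt with h1 | h1
      · exact Or.inr h1
      · left
        have h0 : 0 ≤ (n : ℝ) * t := mul_nonneg hn.le t.2.1
        have hlt : ⌊(n : ℝ) * t⌋₊ < n := by
          rw [Nat.floor_lt h0]; nlinarith
        have hj : ⌊(n : ℝ) * t⌋₊ = (j : ℕ) := by
          have := congrArg Fin.val (show Fin.ofNat n ⌊(n : ℝ) * t⌋₊ = j from ht)
          rwa [Fin.val_ofNat, Nat.mod_eq_of_lt hlt] at this
        have h2 := Nat.floor_le h0
        have h3 := Nat.lt_floor_add_one ((n : ℝ) * t)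
        rw [hj] at h2 h3
        constructor
        · rw [div_le_iff₀ hn]; linarith
        · rw [lt_div_iff₀ hn]; linarith
    rw [← volume_image_subtype_coe measurableSet_Icc]
    refine (measure_mono hsub).trans ((measure_union_le _ _).trans ?_)
    rw [Real.volume_Ico, Real.volume_singleton, add_zero, ← sub_div, add_sub_cancel_left,
      ENNReal.ofReal_div_of_pos hn]
    simp

lemma sum_exp_le (x : ℝ) (n : ℕ) : ∑ k ∈ Finset.range n, Real.exp (x * k)
    ≤ n * (Real.exp (x * ((n - 1) / 2)) * Real.exp ((x * n) ^ 2 / 8)) := by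
  have hrefl : ∑ k ∈ Finset.range n, Real.exp (x * (n - 1 - k))
      = ∑ k ∈ Finset.range n, Real.exp (x * k) := by
    rw [← Finset.sum_range_reflect]
    refine Finset.sum_congr rfl fun k hk => ?_
    have := Finset.mem_range.1 hk
    congr 2
    rw [Nat.cast_sub (by omega), Nat.cast_sub (by omega)]
    push_cast
    ring
  have hpair : ∀ k ∈ Finset.range n, Real.exp (x * k) + Real.exp (x * (n - 1 - k))
      ≤ 2 * (Real.exp (x * ((n - 1) / 2)) * Real.exp ((x * n) ^ 2 / 8)) := by
    intro k hk
    have hk' : (k : ℝ) + 1 ≤ n := by exact_mod_cast Finset.mem_range.1 hk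
    have hk0 : (0 : ℝ) ≤ k := Nat.cast_nonneg k
    set y := x * (k - (n - 1) / 2) with hy
    have e1 : Real.exp (x * k) + Real.exp (x * (n - 1 - k))
        = 2 * (Real.exp (x * ((n - 1) / 2)) * Real.cosh y) := by
      have a1 : x * k = x * ((n - 1) / 2) + y := by rw [hy]; ring
      have a2 : x * (n - 1 - k) = x * ((n - 1) / 2) + -y := by rw [hy]; ring
      rw [a1, a2, Real.exp_add, Real.exp_add, Real.cosh_eq]
      ring
    rw [e1]
    gcongr
    refine (Real.cosh_le_exp_half_sq y).trans (Real.exp_le_exp.2 ?_)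
    have h1 : ((k : ℝ) - (n - 1) / 2) ^ 2 ≤ (n / 2 : ℝ) ^ 2 := by
      apply sq_le_sq'
      · linarith
      · linarith
    have : y ^ 2 ≤ x ^ 2 * (n / 2 : ℝ) ^ 2 := by
      rw [hy, mul_pow]
      exact mul_le_mul_of_nonneg_left h1 (sq_nonneg _)
    nlinarith
  have := Finset.sum_le_sum hpair
  rw [Finset.sum_add_distrib, hrefl, Finset.sum_const, Finset.card_range, nsmul_eq_mul] at this
  linarith

/-- If a mass `a` is spread over distinct levels `g j ≥ l`, with mass at most `1 / n` on each, then
the `(1 + θ)`-th power of the total mass is small compared with the integral of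
`exp (θ (1 + θ) (g - l))`. -/
lemma sum_rpow_le_of_levels {θ : ℝ} (hθ : 0 < θ) {n : ℕ} (hn : 0 < n) {a : Fin n → ℝ}
    (ha0 : ∀ j, 0 ≤ a j) (ha : ∀ j, a j ≤ 1 / n) {g : Fin n → ℕ} (hg : Function.Injective g)
    {l : ℕ} (hl : ∀ j, a j ≠ 0 → l ≤ g j) :
    Real.exp (θ * (1 + θ) * l) * (∑ j, a j) ^ (1 + θ)
      ≤ (2 / n) ^ θ * ∑ j, Real.exp (θ * (1 + θ) * g j) * a j := by
  have hn' : (0 : ℝ) < n := by exact_mod_cast hn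
  have hpq : (1 + θ).HolderConjugate ((1 + θ) / θ) := by
    rw [Real.holderConjugate_iff]
    refine ⟨by linarith, ?_⟩
    field_simp
  have hsplit : ∀ j, a j = (a j ^ (1 / (1 + θ)) * Real.exp (θ * (g j - l)))
      * (a j ^ (1 / ((1 + θ) / θ)) * Real.exp (-(θ * (g j - l)))) := by
    intro j
    have e1 : a j ^ (1 / (1 + θ)) * a j ^ (1 / ((1 + θ) / θ)) = a j := by
      rw [← Real.rpow_add_of_nonneg (ha0 j) (by positivity) (by positivity)]
      have : 1 / (1 + θ) + 1 / ((1 + θ) / θ) = 1 := by field_simp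
      rw [this, Real.rpow_one]
    calc a j = a j * (Real.exp (θ * (g j - l)) * Real.exp (-(θ * (g j - l)))) := by
          rw [← Real.exp_add]; simp
      _ = _ := by
          nth_rewrite 1 [← e1]
          ring
  have hpow : ∀ (j) (s y : ℝ), 0 < s → (a j ^ (1 / s) * Real.exp y) ^ s
      = a j * Real.exp (y * s) := by
    intro j s y hs
    rw [Real.mul_rpow (Real.rpow_nonneg (ha0 j) _) (Real.exp_pos _).le, ← Real.rpow_mul (ha0 j),
      one_div_mul_cancel hs.ne', Real.rpow_one, Real.exp_mul]
  have H := Real.inner_le_Lp_mul_Lq_of_nonneg Finset.univ hpq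
    (f := fun j => a j ^ (1 / (1 + θ)) * Real.exp (θ * (g j - l)))
    (g := fun j => a j ^ (1 / ((1 + θ) / θ)) * Real.exp (-(θ * (g j - l))))
    (fun j _ => mul_nonneg (Real.rpow_nonneg (ha0 j) _) (Real.exp_pos _).le)
    (fun j _ => mul_nonneg (Real.rpow_nonneg (ha0 j) _) (Real.exp_pos _).le)
  simp only [← hsplit, hpow _ _ _ (show (0 : ℝ) < 1 + θ by linarith),
    hpow _ _ _ (show (0 : ℝ) < (1 + θ) / θ by positivity)] at H
  set U := ∑ j, a j * Real.exp (θ * (g j - l) * (1 + θ)) with hU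
  set V := ∑ j, a j * Real.exp (-(θ * (g j - l)) * ((1 + θ) / θ)) with hV
  have hU0 : 0 ≤ U := Finset.sum_nonneg fun j _ => mul_nonneg (ha0 j) (Real.exp_pos _).le
  have hV0 : 0 ≤ V := Finset.sum_nonneg fun j _ => mul_nonneg (ha0 j) (Real.exp_pos _).le
  have hVle : V ≤ 2 / n := by
    have hhalf : Real.exp (-1) ≤ 1 / 2 := by
      rw [Real.exp_neg, ← one_div]
      apply one_div_le_one_div_of_le (by norm_num)
      linarith [Real.exp_one_gt_d9]
    calc V ≤ ∑ j ∈ Finset.univ.filter (fun j => l ≤ g j), 1 / n * Real.exp (-1) ^ (g j - l) := by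
          rw [Finset.sum_filter, hV]
          refine Finset.sum_le_sum fun j _ => ?_
          by_cases hj : l ≤ g j
          · rw [if_pos hj]
            refine mul_le_mul (ha j) ?_ (Real.exp_pos _).le (by positivity)
            rw [← Real.exp_nat_mul]
            apply Real.exp_le_exp.2
            rw [Nat.cast_sub hj]
            have h1 : (l : ℝ) ≤ g j := by exact_mod_cast hj
            have e : -(θ * ((g j : ℝ) - l)) * ((1 + θ) / θ) = -((1 + θ) * (g j - l)) := by
              field_simp
            rw [e]
            nlinarith
          · rw [if_neg hj]
            have : a j = 0 := by
              by_contra h0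
              exact hj (hl j h0)
            rw [this, zero_mul]
      _ ≤ 1 / n * (1 - Real.exp (-1))⁻¹ := by
          rw [← Finset.mul_sum]
          refine mul_le_mul_of_nonneg_left (sum_pow_injOn_le _ _ ?_ (Real.exp_pos _).le
            (by linarith)) (by positivity)
          intro i hi j hj hij
          have hi' := (Finset.mem_filter.1 hi).2
          have hj' := (Finset.mem_filter.1 hj).2
          simp only at hij
          exact hg (by omega)
      _ ≤ 1 / n * 2 := by
          gcongr
          rw [inv_le_comm₀ (by linarith) (by norm_num)]
          linarith
      _ = 2 / n := by ring
  have hS0 : 0 ≤ ∑ j, a j := Finset.sum_nonneg fun j _ => ha0 j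
  have h2 : (∑ j, a j) ^ (1 + θ) ≤ U * (2 / n) ^ θ := by
    calc _ ≤ (U ^ (1 / (1 + θ)) * V ^ (1 / ((1 + θ) / θ))) ^ (1 + θ) :=
          Real.rpow_le_rpow hS0 H (by linarith)
      _ = U * V ^ θ := by
          rw [Real.mul_rpow (Real.rpow_nonneg hU0 _) (Real.rpow_nonneg hV0 _),
            ← Real.rpow_mul hU0, ← Real.rpow_mul hV0]
          have e1 : 1 / (1 + θ) * (1 + θ) = 1 := by field_simp
          have e2 : 1 / ((1 + θ) / θ) * (1 + θ) = θ := by field_simp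
          rw [e1, e2, Real.rpow_one]
      _ ≤ _ := by gcongr
  calc _ ≤ Real.exp (θ * (1 + θ) * l) * (U * (2 / n) ^ θ) := by gcongr
    _ = (2 / n) ^ θ * (Real.exp (θ * (1 + θ) * l) * U) := by ring
    _ = _ := by
        rw [hU, Finset.mul_sum]
        congr 1
        refine Finset.sum_congr rfl fun j _ => ?_
        rw [mul_left_comm, ← Real.exp_add, mul_comm]
        congr 2
        ring

section Sharp

open MeasureTheory

variable {Ω : Type*} [MeasurableSpace Ω] {μ : Measure Ω}

/-- A function `exp (θ / p * g)`, with levels `g` spread evenly over `0, …, n - 1`, has a small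
quasinorm in `Λ_{p,p(1+θ)}`. -/
lemma lambdaNorm_exp_level_le [IsProbabilityMeasure μ] {p θ : ℝ} (hp : 0 < p) (hθ : 0 < θ) {n : ℕ}
    (hn : 0 < n) {L : Ω → Fin n} (hL : Measurable L) (hLμ : ∀ j, μ (L ⁻¹' {j}) ≤ (n : ℝ≥0∞)⁻¹)
    (e : Equiv.Perm (Fin n)) :
    lambdaNorm μ p (p * (1 + θ)) (fun x => Real.exp (θ / p * (e (L x) : ℕ))) ^ (p * (1 + θ))
      ≤ ENNReal.ofReal ((2 / n) ^ θ * (Real.exp (θ * (1 + θ) * ((n - 1) / 2))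
        * Real.exp ((θ * (1 + θ) * n) ^ 2 / 8))) := by
  have hn' : (0 : ℝ) < n := by exact_mod_cast hn
  have hq : 0 < p * (1 + θ) := by positivity
  have hqp : p * (1 + θ) / p = 1 + θ := by field_simp
  have hLm : ∀ j, MeasurableSet (L ⁻¹' {j}) := fun j => hL (measurableSet_singleton j)
  have hcell : ∀ A, MeasurableSet A → lambdaCell μ p (p * (1 + θ))
      (fun x => Real.exp (θ / p * (e (L x) : ℕ))) A ≤ ENNReal.ofReal ((2 / n) ^ θ) *
        ∑ j, ENNReal.ofReal (Real.exp (θ * (1 + θ) * (e j : ℕ))) * μ (A ∩ L ⁻¹' {j}) := by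
    intro A hA
    rcases A.eq_empty_or_nonempty with rfl | hne
    · rw [lambdaCell_empty hp hq]; exact zero_le
    -- the lowest level met by the cell
    obtain ⟨x, hxA, hx⟩ : ∃ x ∈ A, ∀ y ∈ A, (e (L x) : ℕ) ≤ e (L y) := by
      obtain ⟨_, ⟨x, hxA, rfl⟩, hx⟩ := WellFounded.has_min (wellFounded_lt (α := ℕ))
        ((fun x => (e (L x) : ℕ)) '' A) (hne.image _)
      exact ⟨x, hxA, fun y hy => not_lt.1 (hx _ ⟨y, hy, rfl⟩)⟩
    set a : Fin n → ℝ := fun j => (μ (A ∩ L ⁻¹' {j})).toReal with ha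
    have haμ : ∀ j, ENNReal.ofReal (a j) = μ (A ∩ L ⁻¹' {j}) := fun j =>
      ENNReal.ofReal_toReal (measure_ne_top μ _)
    have ha0 : ∀ j, 0 ≤ a j := fun j => ENNReal.toReal_nonneg
    have ha1 : ∀ j, a j ≤ 1 / n := fun j => by
      have h1 : μ (A ∩ L ⁻¹' {j}) ≤ (n : ℝ≥0∞)⁻¹ := (measure_mono Set.inter_subset_right).trans
        (hLμ j)
      have h2 := ENNReal.toReal_mono (by simp [hn.ne']) h1
      simpa using h2
    have hal : ∀ j, a j ≠ 0 → (e (L x) : ℕ) ≤ e j := fun j hj => by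
      have : (A ∩ L ⁻¹' {j}).Nonempty := by
        by_contra hcon
        rw [Set.not_nonempty_iff_eq_empty] at hcon
        exact hj (by simp [ha, hcon])
      obtain ⟨y, hyA, hy⟩ := this
      have hy' : L y = j := hy
      rw [← hy']
      exact hx y hyA
    have hμA : μ A = ENNReal.ofReal (∑ j, a j) := by
      rw [ENNReal.ofReal_sum_of_nonneg fun j _ => ha0 j]
      simp only [haμ]
      have hd : Pairwise fun i j => Disjoint (A ∩ L ⁻¹' {i}) (A ∩ L ⁻¹' {j}) := fun i j hij =>
        ((Set.disjoint_singleton.2 hij).preimage L).mono Set.inter_subset_right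
          Set.inter_subset_right
      rw [← (measure_iUnion hd fun j => hA.inter (hLm j)).trans (tsum_fintype _),
        ← Set.inter_iUnion, ← Set.preimage_iUnion, Set.iUnion_of_singleton, Set.preimage_univ,
        Set.inter_univ]
    have H := sum_rpow_le_of_levels hθ hn ha0 ha1
      (g := fun j => (e j : ℕ)) (fun i j hij => e.injective (Fin.ext hij)) hal
    calc lambdaCell μ p (p * (1 + θ)) (fun x => Real.exp (θ / p * (e (L x) : ℕ))) A
        ≤ ENNReal.ofReal (Real.exp (θ * (1 + θ) * (e (L x) : ℕ)) * (∑ j, a j) ^ (1 + θ)) := by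
          rw [lambdaCell, hqp, hμA, ENNReal.ofReal_mul (Real.exp_pos _).le,
            ENNReal.ofReal_rpow_of_nonneg (Finset.sum_nonneg fun j _ => ha0 j) (by positivity)]
          refine mul_le_mul_left ((ENNReal.rpow_le_rpow (iInf₂_le x hxA) hq.le).trans
            (le_of_eq ?_)) _
          rw [Real.enorm_of_nonneg (Real.exp_pos _).le,
            ENNReal.ofReal_rpow_of_pos (Real.exp_pos _), ← Real.exp_mul]
          congr 2
          field_simp
      _ ≤ _ := ENNReal.ofReal_le_ofReal H
      _ = _ := by
          rw [ENNReal.ofReal_mul (by positivity), ENNReal.ofReal_sum_of_nonneg fun j _ =>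
            mul_nonneg (Real.exp_pos _).le (ha0 j)]
          simp only [ENNReal.ofReal_mul (Real.exp_pos _).le, haμ]
  rw [lambdaNorm_rpow hq]
  refine iSup_le fun P => ?_
  calc _ ≤ ∑ i, ENNReal.ofReal ((2 / n) ^ θ) * ∑ j,
        ENNReal.ofReal (Real.exp (θ * (1 + θ) * (e j : ℕ))) * μ (P.cell i ∩ L ⁻¹' {j}) :=
        Finset.sum_le_sum fun i _ => hcell _ (P.measurableSet_cell i)
    _ = ENNReal.ofReal ((2 / n) ^ θ) * ∑ j,
        ENNReal.ofReal (Real.exp (θ * (1 + θ) * (e j : ℕ))) * μ (L ⁻¹' {j}) := by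
        rw [← Finset.mul_sum, Finset.sum_comm]
        congr 1
        refine Finset.sum_congr rfl fun j _ => ?_
        rw [← Finset.mul_sum]
        congr 1
        have hd : Pairwise fun i i' => Disjoint (P.cell i ∩ L ⁻¹' {j}) (P.cell i' ∩ L ⁻¹' {j}) :=
          fun i i' hi => (P.disjoint hi).mono Set.inter_subset_left Set.inter_subset_left
        rw [← (measure_iUnion hd fun i => (P.measurableSet_cell i).inter (hLm j)).trans
          (tsum_fintype _), ← Set.iUnion_inter, P.iUnion_eq, Set.univ_inter]
    _ ≤ ENNReal.ofReal ((2 / n) ^ θ) * ∑ j,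
        ENNReal.ofReal (Real.exp (θ * (1 + θ) * (e j : ℕ))) * ENNReal.ofReal (1 / n) := by
        gcongr with j
        refine (hLμ j).trans (le_of_eq ?_)
        rw [one_div, ENNReal.ofReal_inv_of_pos hn', ENNReal.ofReal_natCast]
    _ = ENNReal.ofReal ((2 / n) ^ θ * ((∑ k ∈ Finset.range n,
          Real.exp (θ * (1 + θ) * k)) * (1 / n))) := by
        rw [← Finset.sum_mul, ← ENNReal.ofReal_sum_of_nonneg fun j _ => (Real.exp_pos _).le,
          ← ENNReal.ofReal_mul (Finset.sum_nonneg fun j _ => (Real.exp_pos _).le),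
          ← ENNReal.ofReal_mul (by positivity),
          Equiv.sum_comp e fun j : Fin n => Real.exp (θ * (1 + θ) * (j : ℕ)), Finset.sum_range]
    _ ≤ _ := by
        refine ENNReal.ofReal_le_ofReal (mul_le_mul_of_nonneg_left ?_ (by positivity))
        rw [mul_one_div, div_le_iff₀ hn', mul_comm _ (n : ℝ)]
        exact sum_exp_le _ n

end Sharp

/-! ### Lower bounds for the constants of convexity -/

section Test

variable {Ω : Type*} [MeasurableSpace Ω] {N : (Ω → ℝ) → ℝ≥0∞}

lemma ofReal_exp_le_of_le_mul {G κ : ℝ} (hG : 0 < G) {M : ℝ≥0∞}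
    (h : ENNReal.ofReal G ≤ M * ENNReal.ofReal (G * Real.exp (-κ))) :
    ENNReal.ofReal (Real.exp κ) ≤ M := by
  have e1 : Real.exp κ = G * (Real.exp κ / G) := by field_simp
  have e2 : G * Real.exp (-κ) * (Real.exp κ / G) = 1 := by
    rw [Real.exp_neg]
    have := (Real.exp_pos κ).ne'
    field_simp
  rw [e1, ENNReal.ofReal_mul hG.le]
  refine (mul_le_mul_left h _).trans (le_of_eq ?_)
  rw [mul_assoc, ← ENNReal.ofReal_mul (by positivity), e2, ENNReal.ofReal_one, mul_one]

/-- Functions of small quasinorm whose geometric mean is a constant `G` force the constant of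
geometric convexity to be large. -/
lemma ofReal_exp_le_geomConvexityConst
    (hconst : ∀ c : ℝ, ‖c‖ₑ ≤ N fun _ => c) {n : ℕ} (hn : 0 < n) {f : Fin n → Ω → ℝ}
    (hf : ∀ i, Measurable (f i)) (hf0 : ∀ i x, 0 < f i x) {G κ : ℝ} (hG : 0 < G)
    (hprod : ∀ x, ∏ i, f i x = G ^ n) (hN : ∀ i, N (f i) ≤ ENNReal.ofReal (G * Real.exp (-κ))) :
    ENNReal.ofReal (Real.exp κ) ≤ geomConvexityConst N := by
  have hn' : (n : ℝ) ≠ 0 := by exact_mod_cast hn.ne'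
  refine le_sInf fun M hM => ofReal_exp_le_of_le_mul hG ?_
  have h1 := hM n f hn fun i => ⟨hf i, (hN i).trans_lt ENNReal.ofReal_lt_top⟩
  have e : (fun x => (∏ i, |f i x|) ^ (1 / (n : ℝ))) = fun _ => G := by
    ext x
    simp only [abs_of_pos (hf0 _ x)]
    rw [hprod, ← Real.rpow_natCast, ← Real.rpow_mul hG.le, mul_one_div_cancel hn', Real.rpow_one]
  rw [e] at h1
  have h2 := hconst G
  rw [Real.enorm_of_nonneg hG.le] at h2
  refine h2.trans (h1.trans ?_)
  gcongr
  calc (∏ i, N (f i)) ^ (1 / (n : ℝ))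
      ≤ (∏ _i : Fin n, ENNReal.ofReal (G * Real.exp (-κ))) ^ (1 / (n : ℝ)) := by
        refine ENNReal.rpow_le_rpow (Finset.prod_le_prod' fun i _ => hN i) (by positivity)
    _ = _ := by
        rw [Finset.prod_const, Finset.card_univ, Fintype.card_fin, ← ENNReal.rpow_natCast,
          ← ENNReal.rpow_mul, mul_one_div_cancel hn', ENNReal.rpow_one]

/-- The same functions force the constant of `r`-convexity to be large, by the inequality of the
arithmetic and geometric means. -/
lemma IsAdmissibleQuasinorm.ofReal_exp_le_convexityConst (h : IsAdmissibleQuasinorm N)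
    (hconst : ∀ c : ℝ, ‖c‖ₑ ≤ N fun _ => c) {r : ℝ} (hr : 0 < r) {n : ℕ} (hn : 0 < n)
    {f : Fin n → Ω → ℝ} (hf : ∀ i, Measurable (f i)) (hf0 : ∀ i x, 0 < f i x) {G κ : ℝ}
    (hG : 0 < G) (hprod : ∀ x, ∏ i, f i x = G ^ n)
    (hN : ∀ i, N (f i) ≤ ENNReal.ofReal (G * Real.exp (-κ))) :
    ENNReal.ofReal (Real.exp κ) ≤ convexityConst N r := by
  have hn' : (0 : ℝ) < n := by exact_mod_cast hn
  set b := ENNReal.ofReal (G * Real.exp (-κ)) with hb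
  refine le_sInf fun M hM => ofReal_exp_le_of_le_mul hG ?_
  have h1 := hM n f fun i => ⟨hf i, (hN i).trans_lt ENNReal.ofReal_lt_top⟩
  have hpt : ∀ x, (n : ℝ) ^ (1 / r) * G ≤ (∑ i, |f i x| ^ r) ^ (1 / r) := by
    intro x
    have hgm := Real.geom_mean_le_arith_mean_weighted Finset.univ (fun _ : Fin n => 1 / (n : ℝ))
      (fun i => f i x ^ r) (fun _ _ => by positivity)
      (by rw [Finset.sum_const, Finset.card_univ, Fintype.card_fin, nsmul_eq_mul,
        mul_one_div_cancel hn'.ne'])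
      (fun i _ => Real.rpow_nonneg (hf0 i x).le _)
    rw [Real.finsetProd_rpow _ _ fun i _ => Real.rpow_nonneg (hf0 i x).le _,
      Real.finsetProd_rpow _ _ fun i _ => (hf0 i x).le, hprod, ← Real.rpow_natCast,
      ← Real.rpow_mul hG.le, ← Real.rpow_mul hG.le, ← Finset.mul_sum] at hgm
    have e : (n : ℝ) * r * (1 / n) = r := by field_simp
    rw [e, one_div_mul_eq_div, le_div_iff₀ hn'] at hgm
    simp only [abs_of_pos (hf0 _ x)]
    calc (n : ℝ) ^ (1 / r) * G = (G ^ r * n) ^ (1 / r) := by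
          rw [Real.mul_rpow (by positivity) hn'.le, ← Real.rpow_mul hG.le,
            mul_one_div_cancel hr.ne', Real.rpow_one, mul_comm]
      _ ≤ _ := Real.rpow_le_rpow (by positivity) hgm (by positivity)
  have h2 : ‖(n : ℝ) ^ (1 / r) * G‖ₑ ≤ M * (∑ i, N (f i) ^ r) ^ (1 / r) := by
    refine (hconst _).trans (le_trans (h.mono _ _ measurable_const ?_ fun x => ?_) h1)
    · exact (Finset.measurable_sum _ fun i _ => (hf i).abs.pow_const r).pow_const _
    · rw [abs_of_nonneg (by positivity)]
      exact (hpt x).trans (le_abs_self _)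
  have h3 : (∑ i, N (f i) ^ r) ^ (1 / r) ≤ ENNReal.ofReal ((n : ℝ) ^ (1 / r)) * b := by
    calc (∑ i, N (f i) ^ r) ^ (1 / r) ≤ (∑ _i : Fin n, b ^ r) ^ (1 / r) := by
          refine ENNReal.rpow_le_rpow (Finset.sum_le_sum fun i _ => ?_) (by positivity)
          exact ENNReal.rpow_le_rpow (hN i) hr.le
      _ = _ := by
          rw [Finset.sum_const, Finset.card_univ, Fintype.card_fin, nsmul_eq_mul,
            ENNReal.mul_rpow_of_nonneg _ _ (by positivity), ← ENNReal.rpow_mul,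
            mul_one_div_cancel hr.ne', ENNReal.rpow_one, ← ENNReal.ofReal_natCast,
            ENNReal.ofReal_rpow_of_pos hn']
  set A := ENNReal.ofReal ((n : ℝ) ^ (1 / r)) with hA
  have hA0 : A ≠ 0 := by
    rw [hA, ne_eq, ENNReal.ofReal_eq_zero, not_le]
    positivity
  have h4 : A * ENNReal.ofReal G ≤ A * (M * b) := by
    rw [hA, ← ENNReal.ofReal_mul (by positivity), ← hA]
    rw [Real.enorm_of_nonneg (by positivity)] at h2
    refine h2.trans ((mul_le_mul_right h3 M).trans (le_of_eq ?_))
    rw [mul_left_comm]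
  exact (ENNReal.mul_le_mul_iff_right hA0 ENNReal.ofReal_ne_top).1 h4

end Test

open MeasureTheory in
/-- The `n` cyclic shifts of an exponential step function have a constant geometric mean, which
exceeds their quasinorms by the factor `(n / 2) ^ (θ / q) * exp (- (θ (1 + θ) n) ^ 2 / (8 q))` with
`q = p (1 + θ)`. -/
lemma exists_cyclic_family {p θ : ℝ} (hp : 0 < p) (hθ : 0 < θ) (n : ℕ) [NeZero n] :
    ∃ f : Fin n → unitInterval → ℝ, (∀ i, Measurable (f i)) ∧ (∀ i x, 0 < f i x) ∧
      (∀ x, ∏ i, f i x = Real.exp (θ / p * ((n - 1) / 2)) ^ n) ∧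
      ∀ i, lambdaNorm volume p (p * (1 + θ)) (f i) ≤
        ENNReal.ofReal (Real.exp (θ / p * ((n - 1) / 2)) *
          Real.exp (-((θ * Real.log (n / 2) - (θ * (1 + θ) * n) ^ 2 / 8) / (p * (1 + θ))))) := by
  have hn : 0 < n := NeZero.pos n
  have hn' : (0 : ℝ) < n := by exact_mod_cast hn
  have hq : 0 < p * (1 + θ) := by positivity
  obtain ⟨L, hL, hLμ⟩ := exists_measurable_equidistributed n
  refine ⟨fun i x => Real.exp (θ / p * ((Equiv.addRight i (L x) : Fin n) : ℕ)), fun i => ?_,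
    fun i x => Real.exp_pos _, fun x => ?_, fun i => ?_⟩
  · exact (measurable_of_finite fun j : Fin n =>
      Real.exp (θ / p * ((Equiv.addRight i j : Fin n) : ℕ))).comp hL
  · rw [← Real.exp_sum, ← Real.exp_nat_mul, ← Finset.mul_sum]
    congr 1
    have h1 : ∑ i, (((Equiv.addRight i (L x) : Fin n) : ℕ) : ℝ) = ∑ j : Fin n, ((j : ℕ) : ℝ) :=
      Equiv.sum_comp (Equiv.addLeft (L x)) fun j : Fin n => ((j : ℕ) : ℝ)
    have h2 : (∑ j : Fin n, ((j : ℕ) : ℝ)) * 2 = n * (n - 1) := by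
      rw [← Finset.sum_range (fun j => (j : ℝ))]
      have := congrArg (Nat.cast (R := ℝ)) (Finset.sum_range_id_mul_two n)
      push_cast [Nat.cast_sub (Nat.one_le_iff_ne_zero.2 hn.ne')] at this
      exact this
    rw [h1]
    linear_combination (θ / p / 2) * h2
  · have h1 := lambdaNorm_exp_level_le (μ := (volume : Measure unitInterval)) hp hθ hn hL hLμ
      (Equiv.addRight i)
    rw [← ENNReal.rpow_le_rpow_iff hq]
    refine h1.trans (le_of_eq ?_)
    rw [ENNReal.ofReal_rpow_of_pos (by positivity)]
    congr 1
    rw [Real.rpow_def_of_pos (by positivity), ← Real.exp_add, ← Real.exp_add, ← Real.exp_add,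
      ← Real.exp_mul, Real.log_div (by norm_num) hn'.ne', Real.log_div hn'.ne' (by norm_num)]
    congr 1
    field_simp
    ring

/-- With about `θ ^ (-1/2)` levels the gain is of order `θ |log θ|`. -/
lemma exists_gain {p θ : ℝ} (hp : 0 < p) (hθ : 0 < θ) (hθ1 : θ < Real.exp (-12)) :
    ∃ n : ℕ, 0 < n ∧ 1 / 8 * θ * |Real.log θ| / p
      ≤ (θ * Real.log (n / 2) - (θ * (1 + θ) * n) ^ 2 / 8) / (p * (1 + θ)) := by
  have hlog : Real.log θ < -12 := by rwa [Real.log_lt_iff_lt_exp hθ]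
  have hθ2 : θ < 1 := hθ1.trans (Real.exp_lt_one_iff.2 (by norm_num))
  set s := θ ^ (-(1 / 2) : ℝ) with hs
  have hs1 : 1 ≤ s := Real.one_le_rpow_of_pos_of_le_one_of_nonpos hθ hθ2.le (by norm_num)
  have hs2 : s ^ 2 = 1 / θ := by
    rw [hs, ← Real.rpow_natCast, ← Real.rpow_mul hθ.le]
    norm_num [Real.rpow_neg_one]
  have hlogs : Real.log s = -(1 / 2) * Real.log θ := Real.log_rpow hθ _
  refine ⟨⌈s⌉₊, Nat.ceil_pos.2 (by linarith), ?_⟩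
  set n : ℝ := (⌈s⌉₊ : ℝ) with hn
  have hn1 : s ≤ n := Nat.le_ceil s
  have hn2 : n ≤ 2 * s := by
    have := Nat.ceil_lt_add_one (show (0 : ℝ) ≤ s by linarith)
    linarith
  have hlog2 : Real.log 2 ≤ 1 := by linarith [Real.log_two_lt_d9]
  have h1 : -(1 / 2) * Real.log θ - 1 ≤ Real.log (n / 2) := by
    rw [Real.log_div (by linarith) (by norm_num), ← hlogs]
    have := Real.log_le_log (by linarith) hn1
    linarith
  have h2 : (θ * (1 + θ) * n) ^ 2 ≤ 16 * θ := by
    have a1 : n ^ 2 ≤ 4 * (1 / θ) := by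
      rw [← hs2]; nlinarith
    have a2 : (1 + θ) ^ 2 ≤ 4 := by nlinarith
    calc (θ * (1 + θ) * n) ^ 2 = θ ^ 2 * ((1 + θ) ^ 2 * n ^ 2) := by ring
      _ ≤ θ ^ 2 * (4 * (4 * (1 / θ))) := by gcongr
      _ = 16 * θ := by field_simp; norm_num
  rw [abs_of_neg (by linarith), div_le_div_iff₀ hp (by positivity)]
  have h3 : θ * (-(1 / 2) * Real.log θ - 1) ≤ θ * Real.log (n / 2) :=
    mul_le_mul_of_nonneg_left h1 hθ.le
  have h4 : 1 / 4 * θ * -Real.log θ ≤ θ * Real.log (n / 2) - (θ * (1 + θ) * n) ^ 2 / 8 := by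
    nlinarith
  have h5 : 0 ≤ θ * -Real.log θ := mul_nonneg hθ.le (by linarith)
  calc 1 / 8 * θ * -Real.log θ * (p * (1 + θ)) = 1 / 8 * (1 + θ) * (θ * -Real.log θ) * p := by ring
    _ ≤ 1 / 4 * (θ * -Real.log θ) * p := by gcongr; linarith
    _ = 1 / 4 * θ * -Real.log θ * p := by ring
    _ ≤ _ := by gcongr

lemma coe_le_log_of_ofReal_exp_le {x κ : ℝ} {M : ℝ≥0∞} (hx : x ≤ κ)
    (h : ENNReal.ofReal (Real.exp κ) ≤ M) : (x : EReal) ≤ ENNReal.log M := by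
  refine le_trans ?_ (ENNReal.log_monotone h)
  rw [ENNReal.log_ofReal_of_pos (Real.exp_pos _), Real.log_exp]
  exact_mod_cast hx

theorem theorem3p6 :
    -- the upper bound for the constant of r-convexity
    (∀ r p : ℝ, 0 < r → r < p → ∃ c : ℝ,
      ∀ (Ω : Type*) [TopologicalSpace Ω] [CompactSpace Ω] [T2Space Ω]
        [MeasurableSpace Ω] [BorelSpace Ω] (N : (Ω → ℝ) → ℝ≥0∞),
        IsAdmissibleQuasinorm N →
        ∀ q θ : ℝ, q / p = 1 + θ → 0 ≤ θ → θ < 1 →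
          UpperEstimate N p → LowerEstimate N q →
          ENNReal.log (convexityConst N r) ≤ ((θ * (c + |Real.log θ| / p) : ℝ) : EReal)) ∧
    -- the order is sharp, for the spaces Λ_{p,q}[0,1] with q = p (1 + θ)
    (∃ k θ₀ : ℝ, 0 < k ∧ 0 < θ₀ ∧ ∀ p θ : ℝ, 0 < p → 0 < θ → θ < θ₀ →
      IsAdmissibleQuasinorm
        (lambdaNorm (MeasureTheory.volume : MeasureTheory.Measure unitInterval)
          p (p * (1 + θ))) ∧
      UpperEstimate
        (lambdaNorm (MeasureTheory.volume : MeasureTheory.Measure unitInterval)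
          p (p * (1 + θ))) p ∧
      LowerEstimate
        (lambdaNorm (MeasureTheory.volume : MeasureTheory.Measure unitInterval)
          p (p * (1 + θ))) (p * (1 + θ)) ∧
      ((k * θ * |Real.log θ| / p : ℝ) : EReal) ≤
        ENNReal.log (geomConvexityConst
          (lambdaNorm (MeasureTheory.volume : MeasureTheory.Measure unitInterval)
            p (p * (1 + θ)))) ∧
      ∀ r : ℝ, 0 < r → r < p →
        ((k * θ * |Real.log θ| / p : ℝ) : EReal) ≤
          ENNReal.log (convexityConst
            (lambdaNorm (MeasureTheory.volume : MeasureTheory.Measure unitInterval)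
              p (p * (1 + θ))) r)) := by
  refine ⟨fun r p hr hrp => ?_, 1 / 8, Real.exp (-12), by norm_num, Real.exp_pos _, ?_⟩
  · obtain ⟨c, hc⟩ := exists_log_convexityConst_le hr hrp
    refine ⟨c, fun Ω _ _ _ _ _ N h q θ hq hθ hθ1 hU hL => hc Ω N h θ hθ hθ1 hU ?_⟩
    have hp : 0 < p := hr.trans hrp
    rwa [← hq, mul_div_cancel₀ _ hp.ne']
  · intro p θ hp hθ hθ1
    have hpq : p ≤ p * (1 + θ) := by nlinarith
    have hadm := isAdmissibleQuasinorm_lambdaNorm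
      (μ := (MeasureTheory.volume : MeasureTheory.Measure unitInterval)) hp hpq
    obtain ⟨n, hn, hgain⟩ := exists_gain hp hθ hθ1
    have : NeZero n := ⟨hn.ne'⟩
    obtain ⟨f, hf, hf0, hprod, hN⟩ := exists_cyclic_family hp hθ n
    have hconst := enorm_le_lambdaNorm_const (p := p)
      (μ := (MeasureTheory.volume : MeasureTheory.Measure unitInterval)) (hp.trans_le hpq)
    refine ⟨hadm, lambdaNorm_upperEstimate hp hpq, lambdaNorm_lowerEstimate (hp.trans_le hpq), ?_,
      fun r hr _ => ?_⟩
    · exact coe_le_log_of_ofReal_exp_le hgain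
        (ofReal_exp_le_geomConvexityConst hconst hn hf hf0 (Real.exp_pos _) hprod hN)
    · exact coe_le_log_of_ofReal_exp_le hgain
        (hadm.ofReal_exp_le_convexityConst hconst hr hn hf hf0 (Real.exp_pos _) hprod hN)
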